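/- **Setting.** Let $(\Omega,\mathcal F,\mathsf P)$ be a probability space. Let $I$ and $K$ be nonempty finite sets, let $(H_i)_{i\in I}$ and $(G_k)_{k\in K}$ be Euclidean spaces, and for all $i\in I$, $k\in K$ let $A_i\colon H_i\to 2^{H_i}$ and $B_k\colon G_k\to 2^{G_k}$ be maximally monotone and $L_{ki}\colon H_i\to G_k$ be linear. Let $\mathscr P$ be the set of all $\overline x\in\prod_{i}H_i$ such that $$(\forall i\in I)\quad 0\in A_i\overline x_i+\sum_{k\in K}L_{ki}^*\Big(B_k\Big(\sum_{j\in I}L_{kj}\overline x_j\Big)\Big),$$ and $\mathscr D$ the set of all $\overline v^*\in\prod_k G_k$ for which there is $x\in\prod_iH_i$ with $x_i\in A_i^{-1}\big(-\sum_{k}L_{ki}^*\overline v_k^*\big)$ for every $i\in I$ and $\sum_{i}L_{ki}x_i\in B_k^{-1}\overline v_k^*$ for every $k\in K$. The resolvent of a maximally monotone operator $M$ is $J_M=(\mathrm{Id}+M)^{-1}$. **Random blocks.** Let $N\ge1$ be an integer and let $(\pi_i)_{i\in I}$ and $(\zeta_k)_{k\in K}$ be in $]0,1]$. Let $(I_n)_{n\in\mathbb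 N}$ and $(K_n)_{n\in\mathbb N}$ be random nonempty subsets of $I$ and $K$, respectively, such that $I_0=I$, $K_0=K$, for every $i\in I$ the events $([i\in I_n])_{n\ge1}$ are independent, for every $k\in K$ the events $([k\in K_n])_{n\ge1}$ are independent, and, for every $n\in\mathbb N$, $i\in I$, $k\in K$, $$\mathsf P\Big(i\in\bigcup_{j=n}^{n+N-1}I_j\Big)\ge\pi_i,\qquad \mathsf P\Big(k\in\bigcup_{j=n}^{n+N-1}K_j\Big)\ge\zeta_k.$$ **Algorithm.** Let $\varepsilon\in\,]0,1[$, $\rho\in[2,+\infty[$, and let $\gamma_{i,n}$ and $\mu_{k,n}$ be (deterministic) numbers in $[\varepsilon,1/\varepsilon]$. Let $x_{i,0}\in L^2(\Omega;H_i)$ and $v^*_{k,0}\in L^2(\Omega;G_k)$. Almost surely, for $n=0,1,\dots$, - for every $i\in I_n$: $a_{i,n}=J_{\gamma_{i,n}A_i}\big(x_{i,n}-\gamma_{i,n}l^*_{i,n}\big)$ and $a^*_{i,n}=\gamma_{i,n}^{-1}(x_{i,n}-a_{i,n})-l^*_{i,n}$, where $l^*_{i,n}=\sum_kL_{ki}^*v^*_{k,n}$;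 for every $i\in I\setminus I_n$: $a_{i,n}=a_{i,n-1}$ and $a^*_{i,n}=a^*_{i,n-1}$; - for every $k\in K_n$: $b_{k,n}=J_{\mu_{k,n}B_k}\big(l_{k,n}+\mu_{k,n}v^*_{k,n}\big)$ and $b^*_{k,n}=v^*_{k,n}+\mu_{k,n}^{-1}(l_{k,n}-b_{k,n})$, where $l_{k,n}=\sum_iL_{ki}x_{i,n}$; for every $k\in K\setminus K_n$: $b_{k,n}=b_{k,n-1}$ and $b^*_{k,n}=b^*_{k,n-1}$; - $t^*_{i,n}=a^*_{i,n}+\sum_kL_{ki}^*b^*_{k,n}$ for every $i\in I$, and $t_{k,n}=b_{k,n}-\sum_iL_{ki}a_{i,n}$ for every $k\in K$; - $\Delta_n=\sum_i\big(\langle x_{i,n},t^*_{i,n}\rangle-\langle a_{i,n},a^*_{i,n}\rangle\big)+\sum_k\big(\langle t_{k,n},v^*_{k,n}\rangle-\langle b_{k,n},b^*_{k,n}\rangle\big)$; - $\theta_n=\dfrac{1_{[\Delta_n>0]}\,\Delta_n}{\sum_i\|t^*_{i,n}\|^2+\sum_k\|t_{k,n}\|^2+1_{[\Delta_n\le0]}}$;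 - $x_{i,n+1}=x_{i,n}-\lambda_n\theta_nt^*_{i,n}$ for every $i\in I$, and $v^*_{k,n+1}=v^*_{k,n}-\lambda_n\theta_nt_{k,n}$ for every $k\in K$. Here the relaxation parameter $\lambda_n$ is a random variable in $L^\infty(\Omega;[\varepsilon,\rho])$ that is independent of the $\sigma$-algebra generated by the iterates $(x_{i,j})_{i\in I}$, $(v^*_{k,j})_{k\in K}$, $0\le j\le n$, together with the direction $d_n=\theta_n\big((t^*_{i,n})_{i\in I},(t_{k,n})_{k\in K}\big)$. **Theorem.** Suppose that $\mathscr D\ne\varnothing$ and that $\inf_{n\in\mathbb N}\mathsf E\big(\lambda_n(2-\lambda_n)\big)>0$. Then there exist a $\mathscr P$-valued random variable $\overline x$ and a $\mathscr D$-valued random variable $\overline v^*$ such that, for every $i\in I$ and every $k\in K$, $x_{i,n}\to\overline x_i$ almost surely and $v^*_{k,n}\to\overline v^*_k$ almost surely. -/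

import Mathlib

open MeasureTheory ProbabilityTheory Filter Topology
open scoped Pointwise

namespace KTSplitting

/-! ### Set-valued operators on a real inner product space -/

section Operators

variable {E : Type*} [NormedAddCommGroup E] [InnerProductSpace ℝ E]

/-- A set-valued operator `M : E → 2^E` is maximally monotone: a pair `(x, u)` lies in its graph
if and only if `⟪x - y, u - w⟫ ≥ 0` for every `(y, w)` in its graph. -/
def IsMaximallyMonotone (M : E → Set E) : Prop :=
  ∀ x u : E, u ∈ M x ↔ ∀ y w : E, w ∈ M y → 0 ≤ inner ℝ (x - y) (u - w)

/-- The inverse `M⁻¹` of a set-valued operator: `x ∈ M⁻¹ u` if and only if `u ∈ M x`. -/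
def inverseOp (M : E → Set E) (u : E) : Set E := {x | u ∈ M x}

/-- The resolvent `J_M = (Id + M)⁻¹`, as a set-valued operator. It is single-valued and
everywhere defined when `M` is maximally monotone, in which case `p ∈ resolventOp M x` expresses
that `p = J_M x`. -/
def resolventOp (M : E → Set E) : E → Set E := inverseOp fun p => {p} + M p

end Operators

/-! ### The primal-dual problem -/

section Problem

variable {ι κ : Type*} [Fintype ι] [Fintype κ]
  {H : ι → Type*} [∀ i, NormedAddCommGroup (H i)] [∀ i, InnerProductSpace ℝ (H i)]
  [∀ i, FiniteDimensional ℝ (H i)]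
  {G : κ → Type*} [∀ k, NormedAddCommGroup (G k)] [∀ k, InnerProductSpace ℝ (G k)]
  [∀ k, FiniteDimensional ℝ (G k)]

/-- Primal solutions: `0 ∈ A_i x_i + ∑ₖ L_{ki}^* (B_k (∑ⱼ L_{kj} x_j))` for every `i`. -/
def primalSolutions (A : ∀ i, H i → Set (H i)) (B : ∀ k, G k → Set (G k))
    (L : ∀ k i, H i →ₗ[ℝ] G k) : Set (∀ i, H i) :=
  {x | ∀ i, (0 : H i) ∈ A i (x i) + ∑ k, (L k i).adjoint '' B k (∑ j, L k j (x j))}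

/-- Dual solutions: those `v` for which some `x` satisfies `x_i ∈ A_i⁻¹ (-∑ₖ L_{ki}^* v_k)` for
every `i` and `∑ᵢ L_{ki} x_i ∈ B_k⁻¹ v_k` for every `k`. -/
def dualSolutions (A : ∀ i, H i → Set (H i)) (B : ∀ k, G k → Set (G k))
    (L : ∀ k i, H i →ₗ[ℝ] G k) : Set (∀ k, G k) :=
  {v | ∃ x : ∀ i, H i,
    (∀ i, x i ∈ inverseOp (A i) (-∑ k, (L k i).adjoint (v k))) ∧
    (∀ k, ∑ i, L k i (x i) ∈ inverseOp (B k) (v k))}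

/-- The recursion of the block-iterative Kuhn–Tucker projective splitting method, along one
outcome. `I n` and `K n` are the blocks activated at iteration `n`, `γ n i` and `μ n k` the
proximal parameters, `lam n` the relaxation parameter. The iterates are `x n` and `v n` (the
latter written `v*_n` on paper); `a n`, `as n` (`a*_n`), `b n`, `bs n` (`b*_n`), `ts n` (`t*_n`),
`t n`, `Δ n`, `θ n` are the auxiliary variables. Nothing is asked of a block that is not activated
at iteration `0`, since all the blocks are activated then. -/
structure IsTrajectory (A : ∀ i, H i → Set (H i)) (B : ∀ k, G k → Set (G k))
    (L : ∀ k i, H i →ₗ[ℝ] G k) (γ : ℕ → ι → ℝ) (μ : ℕ → κ → ℝ)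
    (I : ℕ → Set ι) (K : ℕ → Set κ) (lam : ℕ → ℝ)
    (x : ℕ → ∀ i, H i) (v : ℕ → ∀ k, G k)
    (a as : ℕ → ∀ i, H i) (b bs : ℕ → ∀ k, G k)
    (ts : ℕ → ∀ i, H i) (t : ℕ → ∀ k, G k) (Δ θ : ℕ → ℝ) : Prop where
  a_active : ∀ n, ∀ i ∈ I n,
    a n i ∈ resolventOp (fun y => γ n i • A i y)
      (x n i - γ n i • ∑ k, (L k i).adjoint (v n k))
  as_active : ∀ n, ∀ i ∈ I n,
    as n i = (γ n i)⁻¹ • (x n i - a n i) - ∑ k, (L k i).adjoint (v n k)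
  a_inactive : ∀ n, ∀ i ∉ I (n + 1), a (n + 1) i = a n i
  as_inactive : ∀ n, ∀ i ∉ I (n + 1), as (n + 1) i = as n i
  b_active : ∀ n, ∀ k ∈ K n,
    b n k ∈ resolventOp (fun y => μ n k • B k y)
      (∑ i, L k i (x n i) + μ n k • v n k)
  bs_active : ∀ n, ∀ k ∈ K n,
    bs n k = v n k + (μ n k)⁻¹ • (∑ i, L k i (x n i) - b n k)
  b_inactive : ∀ n, ∀ k ∉ K (n + 1), b (n + 1) k = b n k
  bs_inactive : ∀ n, ∀ k ∉ K (n + 1), bs (n + 1) k = bs n k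
  ts_eq : ∀ n i, ts n i = as n i + ∑ k, (L k i).adjoint (bs n k)
  t_eq : ∀ n k, t n k = b n k - ∑ i, L k i (a n i)
  Δ_eq : ∀ n, Δ n =
    ∑ i, (inner ℝ (x n i) (ts n i) - inner ℝ (a n i) (as n i)) +
      ∑ k, (inner ℝ (t n k) (v n k) - inner ℝ (b n k) (bs n k))
  θ_eq : ∀ n, θ n =
    (if 0 < Δ n then Δ n else 0) /
      (∑ i, ‖ts n i‖ ^ 2 + ∑ k, ‖t n k‖ ^ 2 + (if Δ n ≤ 0 then 1 else 0))
  x_succ : ∀ n i, x (n + 1) i = x n i - (lam n * θ n) • ts n i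
  v_succ : ∀ n k, v (n + 1) k = v n k - (lam n * θ n) • t n k

end Problem

/-! ### Random block selection -/

/-- `(I_n)` is a sequence of random nonempty subsets of `ι` such that, for every `i`, the events
`[i ∈ I_n]` with `n ≥ 1` are independent, `I_0` is the whole of `ι`, and `i` is selected over any
`N` consecutive iterations with probability at least `p i ∈ ]0, 1]`. -/
structure IsBlockSelection {Ω ι : Type*} [MeasurableSpace Ω] (P : Measure Ω) (N : ℕ)
    (p : ι → ℝ) (I : ℕ → Ω → Set ι) : Prop where
  p_mem : ∀ i, p i ∈ Set.Ioc (0 : ℝ) 1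
  measurableSet_mem : ∀ n i, MeasurableSet {ω | i ∈ I n ω}
  nonempty : ∀ n, ∀ᵐ ω ∂P, (I n ω).Nonempty
  prod_eq : ∀ i, ∀ s : Finset ℕ, (∀ n ∈ s, 0 < n) →
    P (⋂ n ∈ s, {ω | i ∈ I n ω}) = ∏ n ∈ s, P {ω | i ∈ I n ω}
  zero : ∀ᵐ ω ∂P, I 0 ω = Set.univ
  le_prob : ∀ n i, p i ≤ P.real {ω | i ∈ ⋃ j ∈ Finset.Ico n (n + N), I j ω}

end KTSplitting

set_option linter.unusedSectionVars false

namespace KTSplitting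

/-! ### Monotone operators and their resolvents. -/

section Operators

variable {E : Type*} [NormedAddCommGroup E] [InnerProductSpace ℝ E] {M : E → Set E}

/-! Write `Z` for `kuhnTucker`; its two coordinates are primal and dual solutions, and a dual
solution gives a point of `Z`. Since `(a, as)` and `(b, bs)` stay in the graphs of the operators,
monotonicity places `Z` in the half-space cut out by `Δ n` and `(ts n, t n)` (`Δ_le`). The direction
`d` is thus a projection step, and for every `z` in `Z` the squared distance to `z` drops by at
least `lam * (2 - lam) * ‖d‖ ^ 2` (`sqDist_succ_le`).

This quantity is negative when `lam > 2`, so there is no pathwise Fejér monotonicity. For one fixed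
`z`, independence of `lam n` and `d` lets the mean of `lam * (2 - lam)` factor out, and that mean is
bounded below by a positive constant. Hence the expectations of `‖d‖ ^ 2` are summable, and almost
surely so is `‖d‖ ^ 2` itself (`ae_summable_of_random_relaxation`).

The rest is pathwise. As `lam * (2 - lam) ≥ -ρ ^ 2`, the squared distance to each point of `Z`
decreases up to a summable error and so converges. It then suffices to find one cluster point in
`Z`. Almost surely some window length `M` occurs infinitely often with every block activated in the
window (`ae_exists_frequently_activated`). At such times the stored `(a, as)` and `(b, bs)` were
computed from iterates at most `M` steps old, which differ little from the current ones because the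
steps vanish. Then `Δ` controls the residuals (`exists_sqNorm_residual_le`), which tend to zero, and
closedness of the graphs concludes (`mem_kuhnTucker_of_tendsto`). -/

theorem IsMaximallyMonotone.inner_nonneg (hM : IsMaximallyMonotone M) {x y u w : E}
    (hu : u ∈ M x) (hw : w ∈ M y) : 0 ≤ inner ℝ (x - y) (u - w) :=
  (hM x u).1 hu y w hw

/-- The graph of a maximally monotone operator is sequentially closed. -/
theorem IsMaximallyMonotone.mem_of_tendsto (hM : IsMaximallyMonotone M) {xs us : ℕ → E} {x u : E}
    (hmem : ∀ n, us n ∈ M (xs n)) (hx : Tendsto xs atTop (𝓝 x)) (hu : Tendsto us atTop (𝓝 u)) :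
    u ∈ M x := by
  refine (hM x u).2 fun y w hw => ?_
  refine ge_of_tendsto' ((hx.sub_const y).inner (hu.sub_const w)) fun n => ?_
  exact hM.inner_nonneg (hmem n) hw

theorem inv_smul_sub_mem_of_mem_resolventOp {γ : ℝ} (hγ : γ ≠ 0) {x p : E}
    (hp : p ∈ resolventOp (fun y => γ • M y) x) : γ⁻¹ • (x - p) ∈ M p := by
  simp only [resolventOp, inverseOp, Set.mem_ofPred_eq, Set.singleton_add, Set.mem_image,
    Set.mem_smul_set] at hp
  obtain ⟨_, ⟨u, hu, rfl⟩, rfl⟩ := hp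
  simpa [smul_smul, inv_mul_cancel₀ hγ] using hu

/-- Monotonicity at the graph points above `p` and `q` gives `‖p - q‖ ^ 2 ≤ ⟪p - q, x - y⟫`;
Cauchy–Schwarz finishes. -/
theorem IsMaximallyMonotone.norm_sub_le_of_mem_resolventOp (hM : IsMaximallyMonotone M) {γ : ℝ}
    (hγ : 0 < γ) {x y p q : E} (hp : p ∈ resolventOp (fun y => γ • M y) x)
    (hq : q ∈ resolventOp (fun y => γ • M y) y) : ‖p - q‖ ≤ ‖x - y‖ := by
  have h := hM.inner_nonneg (inv_smul_sub_mem_of_mem_resolventOp hγ.ne' hp)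
    (inv_smul_sub_mem_of_mem_resolventOp hγ.ne' hq)
  rw [← smul_sub, inner_smul_right] at h
  have h1 : 0 ≤ inner ℝ (p - q) ((x - y) - (p - q)) := by
    have := nonneg_of_mul_nonneg_right h (inv_pos.2 hγ)
    rwa [show x - y - (p - q) = x - p - (y - q) by abel]
  rw [inner_sub_right, real_inner_self_eq_norm_sq] at h1
  have h2 := real_inner_le_norm (p - q) (x - y)
  by_contra! hlt
  nlinarith [norm_nonneg (x - y), norm_nonneg (p - q)]

/-- The resolvent of a maximally monotone operator is the restriction of a continuous map. -/
theorem IsMaximallyMonotone.exists_continuous_eq_resolventOp [FiniteDimensional ℝ E]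
    (hM : IsMaximallyMonotone M) {γ : ℝ} (hγ : 0 < γ) :
    ∃ g : E → E, Continuous g ∧ ∀ x p, p ∈ resolventOp (fun y => γ • M y) x → p = g x := by
  classical
  let s : Set E := {x | ∃ p, p ∈ resolventOp (fun y => γ • M y) x}
  let f : E → E := fun x => if h : ∃ p, p ∈ resolventOp (fun y => γ • M y) x then h.choose else 0
  have hf : ∀ x ∈ s, f x ∈ resolventOp (fun y => γ • M y) x := fun x hx => by
    have hx' : ∃ p, p ∈ resolventOp (fun y => γ • M y) x := hx
    simp only [f, dif_pos hx']
    exact hx'.choose_spec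
  have hlip : LipschitzOnWith 1 f s := LipschitzOnWith.of_dist_le_mul fun x hx y hy => by
    simpa [dist_eq_norm] using hM.norm_sub_le_of_mem_resolventOp hγ (hf x hx) (hf y hy)
  -- Extending from the domain `s` of the resolvent avoids Minty's theorem that `s` is the whole
  -- space.
  obtain ⟨g, hg, hgf⟩ := hlip.extend_finite_dimension
  refine ⟨g, hg.continuous, fun x p hp => ?_⟩
  have hx : x ∈ s := ⟨p, hp⟩
  have := hM.norm_sub_le_of_mem_resolventOp hγ hp (hf x hx)
  rw [← hgf hx]
  simpa [sub_eq_zero] using this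

end Operators

/-! ### Quasi-monotone real sequences. -/

section Scalar

/-- A nonnegative sequence which decreases up to summable errors converges. -/
theorem exists_tendsto_of_le_add_summable {Y e : ℕ → ℝ} (hY : ∀ n, 0 ≤ Y n) (he : Summable e)
    (he0 : ∀ n, 0 ≤ e n) (h : ∀ n, Y (n + 1) ≤ Y n + e n) : ∃ l, Tendsto Y atTop (𝓝 l) := by
  -- Subtracting the accumulated errors makes the sequence decreasing, with lower bound minus their
  -- total.
  let u : ℕ → ℝ := fun n => Y n - ∑ j ∈ Finset.range n, e j
  have hanti : Antitone u := antitone_nat_of_succ_le fun n => by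
    simp only [u, Finset.sum_range_succ]
    linarith [h n]
  have hbdd : BddBelow (Set.range u) := ⟨-∑' j, e j, by
    rintro _ ⟨n, rfl⟩
    have := he.sum_le_tsum (Finset.range n) fun j _ => he0 j
    simp only [u]
    linarith [hY n]⟩
  have hu := tendsto_atTop_ciInf hanti hbdd
  refine ⟨_, (hu.add he.hasSum.tendsto_sum_nat).congr fun n => ?_⟩
  simp [u]

end Scalar

/-! ### Last activation times, bounded delays and norm bounds. -/

section Sequences

/-- An inactive block keeps its old value, so the current value is the one computed at the last
activation, which is not before `m`. -/
theorem exists_last_activation {ι α : Type*} {I : ℕ → Set ι} {i : ι} {f : ℕ → α}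
    (hf : ∀ n, i ∉ I (n + 1) → f (n + 1) = f n) {m n : ℕ} (hmn : m ≤ n) (hi : i ∈ I m) :
    ∃ s, m ≤ s ∧ s ≤ n ∧ i ∈ I s ∧ f n = f s := by
  induction n, hmn using Nat.le_induction with
  | base => exact ⟨m, le_rfl, le_rfl, hi, rfl⟩
  | succ n hmn ih =>
    by_cases h : i ∈ I (n + 1)
    · exact ⟨n + 1, by omega, le_rfl, h, rfl⟩
    · obtain ⟨s, h1, h2, h3, h4⟩ := ih
      exact ⟨s, h1, by omega, h3, (hf n h).trans h4⟩

/-- If the increments of a sequence vanish, so do the differences between terms whose indices are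
at bounded distance. -/
theorem tendsto_sub_of_bounded_gap {V : Type*} [SeminormedAddCommGroup V] {z : ℕ → V} {δ : ℕ → ℝ}
    (hz : ∀ n, ‖z (n + 1) - z n‖ ≤ δ n) (hδ : Tendsto δ atTop (𝓝 0)) {φ s : ℕ → ℕ} {M : ℕ}
    (hφ : Tendsto φ atTop atTop) (hs : ∀ n, s n ≤ φ n) (hsM : ∀ n, φ n ≤ s n + M) :
    Tendsto (fun n => z (s n) - z (φ n)) atTop (𝓝 0) := by
  rw [tendsto_zero_iff_norm_tendsto_zero, Metric.tendsto_atTop]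
  intro η hη
  have hη' : 0 < η / (M + 1) := by positivity
  obtain ⟨J, hJ⟩ := eventually_atTop.1 (hδ.eventually (gt_mem_nhds hη'))
  -- The margin `M` keeps every index between `s n` and `φ n` above `J`, where each increment is
  -- below `η / (M + 1)`.
  obtain ⟨n₀, hn₀⟩ := eventually_atTop.1 (hφ.eventually_ge_atTop (J + M))
  refine ⟨n₀, fun n hn => ?_⟩
  have h1 := hn₀ n hn
  have h2 := hs n
  have h3 := hsM n
  have h4 : dist (z (s n)) (z (φ n)) ≤ ∑ j ∈ Finset.Ico (s n) (φ n), η / (M + 1) := by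
    refine dist_le_Ico_sum_of_dist_le h2 fun {j} hj _ => ?_
    rw [dist_comm, dist_eq_norm]
    exact (hz j).trans (hJ j (by omega)).le
  rw [dist_eq_norm, sub_zero, norm_norm, ← dist_eq_norm]
  refine h4.trans_lt ?_
  rw [Finset.sum_const, nsmul_eq_mul, Nat.card_Ico]
  have h5 : ((φ n - s n : ℕ) : ℝ) ≤ M := by exact_mod_cast (by omega : φ n - s n ≤ M)
  calc ((φ n - s n : ℕ) : ℝ) * (η / (M + 1)) ≤ M * (η / (M + 1)) := by gcongr
    _ < (M + 1) * (η / (M + 1)) := by gcongr; linarith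
    _ = η := by field_simp

theorem exists_norm_sum_apply_sq_le {ι : Type*} [Fintype ι] {V : ι → Type*} {W : Type*}
    [∀ i, NormedAddCommGroup (V i)] [∀ i, NormedSpace ℝ (V i)] [∀ i, FiniteDimensional ℝ (V i)]
    [NormedAddCommGroup W] [NormedSpace ℝ W] (F : ∀ i, V i →ₗ[ℝ] W) :
    ∃ C : ℝ, 0 ≤ C ∧ ∀ y : ∀ i, V i, ‖∑ i, F i (y i)‖ ^ 2 ≤ C * ∑ i, ‖y i‖ ^ 2 := by
  refine ⟨∑ i, ‖(F i).toContinuousLinearMap‖ ^ 2, by positivity, fun y => ?_⟩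
  have h1 : ‖∑ i, F i (y i)‖ ≤ ∑ i, ‖(F i).toContinuousLinearMap‖ * ‖y i‖ :=
    norm_sum_le_of_le _ fun i _ => (F i).toContinuousLinearMap.le_opNorm (y i)
  calc ‖∑ i, F i (y i)‖ ^ 2 ≤ (∑ i, ‖(F i).toContinuousLinearMap‖ * ‖y i‖) ^ 2 := by gcongr
    _ ≤ _ := Finset.sum_mul_sq_le_sq_mul_sq _ _ _

theorem norm_add_sq_le {V : Type*} [SeminormedAddCommGroup V] (y z : V) :
    ‖y + z‖ ^ 2 ≤ 2 * (‖y‖ ^ 2 + ‖z‖ ^ 2) :=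
  (by gcongr; exact norm_add_le y z : ‖y + z‖ ^ 2 ≤ (‖y‖ + ‖z‖) ^ 2).trans add_sq_le

end Sequences

/-! ### The Kuhn–Tucker set and the residual estimate. -/

section Problem

variable {ι κ : Type*} [Fintype ι] [Fintype κ]
  {H : ι → Type*} [∀ i, NormedAddCommGroup (H i)] [∀ i, InnerProductSpace ℝ (H i)]
  [∀ i, FiniteDimensional ℝ (H i)]
  {G : κ → Type*} [∀ k, NormedAddCommGroup (G k)] [∀ k, InnerProductSpace ℝ (G k)]
  [∀ k, FiniteDimensional ℝ (G k)]

/-- The Kuhn–Tucker set of the primal-dual problem. -/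
def kuhnTucker (A : ∀ i, H i → Set (H i)) (B : ∀ k, G k → Set (G k))
    (L : ∀ k i, H i →ₗ[ℝ] G k) : Set ((∀ i, H i) × (∀ k, G k)) :=
  {z | (∀ i, -∑ k, (L k i).adjoint (z.2 k) ∈ A i (z.1 i)) ∧
    ∀ k, z.2 k ∈ B k (∑ i, L k i (z.1 i))}

theorem fst_mem_primalSolutions {A : ∀ i, H i → Set (H i)} {B : ∀ k, G k → Set (G k)}
    {L : ∀ k i, H i →ₗ[ℝ] G k} {z : (∀ i, H i) × (∀ k, G k)} (hz : z ∈ kuhnTucker A B L) :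
    z.1 ∈ primalSolutions A B L := fun i =>
  Set.mem_add.2 ⟨_, hz.1 i, ∑ k, (L k i).adjoint (z.2 k),
    Set.finsetSum_mem_finsetSum _ _ _ fun k _ => ⟨_, hz.2 k, rfl⟩, neg_add_cancel _⟩

theorem snd_mem_dualSolutions {A : ∀ i, H i → Set (H i)} {B : ∀ k, G k → Set (G k)}
    {L : ∀ k i, H i →ₗ[ℝ] G k} {z : (∀ i, H i) × (∀ k, G k)} (hz : z ∈ kuhnTucker A B L) :
    z.2 ∈ dualSolutions A B L := ⟨z.1, hz.1, hz.2⟩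

theorem kuhnTucker_nonempty {A : ∀ i, H i → Set (H i)} {B : ∀ k, G k → Set (G k)}
    {L : ∀ k i, H i →ₗ[ℝ] G k} (h : (dualSolutions A B L).Nonempty) :
    (kuhnTucker A B L).Nonempty := by
  obtain ⟨v, x, hx, hv⟩ := h
  exact ⟨(x, v), hx, hv⟩

/-- The coupling of primal and dual variables is skew; this identity cancels all the cross terms in
the formulas for `Δ`. -/
theorem sum_inner_sum_adjoint (L : ∀ k i, H i →ₗ[ℝ] G k) (x : ∀ i, H i) (v : ∀ k, G k) :
    ∑ i, inner ℝ (x i) (∑ k, (L k i).adjoint (v k)) =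
      ∑ k, inner ℝ (∑ i, L k i (x i)) (v k) := by
  simp only [inner_sum, sum_inner, LinearMap.adjoint_inner_right]
  exact Finset.sum_comm

/-- The squared distance of the product Hilbert space. -/
def sqDist (x : ∀ i, H i) (v : ∀ k, G k) (z : (∀ i, H i) × (∀ k, G k)) : ℝ :=
  ∑ i, ‖x i - z.1 i‖ ^ 2 + ∑ k, ‖v k - z.2 k‖ ^ 2

theorem sqDist_nonneg (x : ∀ i, H i) (v : ∀ k, G k) (z : (∀ i, H i) × (∀ k, G k)) :
    0 ≤ sqDist x v z := by unfold sqDist; positivity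

/-- The squared norm of the product Hilbert space. -/
def sqNorm (x : ∀ i, H i) (v : ∀ k, G k) : ℝ := ∑ i, ‖x i‖ ^ 2 + ∑ k, ‖v k‖ ^ 2

theorem sqNorm_nonneg (x : ∀ i, H i) (v : ∀ k, G k) : 0 ≤ sqNorm x v := by
  unfold sqNorm; positivity

theorem norm_fst_sq_le_sqNorm (x : ∀ i, H i) (v : ∀ k, G k) (i : ι) : ‖x i‖ ^ 2 ≤ sqNorm x v :=
  (Finset.single_le_sum (f := fun i => ‖x i‖ ^ 2) (fun _ _ => by positivity)
    (Finset.mem_univ i)).trans (le_add_of_nonneg_right (by positivity))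

theorem norm_snd_sq_le_sqNorm (x : ∀ i, H i) (v : ∀ k, G k) (k : κ) : ‖v k‖ ^ 2 ≤ sqNorm x v :=
  (Finset.single_le_sum (f := fun k => ‖v k‖ ^ 2) (fun _ _ => by positivity)
    (Finset.mem_univ k)).trans (le_add_of_nonneg_left (by positivity))

/-- Boundedness of a linear map between finite-dimensional spaces. In the application `p = as + L*
v`, `q = bs - v`, `u = x - a` and `w = L x - b`, and the left side is the squared norm of `(ts, t)`.
-/
theorem exists_sqNorm_direction_le (L : ∀ k i, H i →ₗ[ℝ] G k) :
    ∃ C : ℝ, 0 ≤ C ∧ ∀ (p u : ∀ i, H i) (q w : ∀ k, G k),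
      sqNorm (fun i => p i + ∑ k, (L k i).adjoint (q k)) (fun k => ∑ i, L k i (u i) - w k) ≤
        C * (sqNorm p q + sqNorm u w) := by
  choose c hc0 hc using fun i => exists_norm_sum_apply_sq_le fun k => (L k i).adjoint
  choose d hd0 hd using fun k => exists_norm_sum_apply_sq_le fun i => L k i
  refine ⟨2 * (1 + ∑ i, c i + ∑ k, d k), by
    have := Finset.sum_nonneg fun i (_ : i ∈ Finset.univ) => hc0 i
    have := Finset.sum_nonneg fun k (_ : k ∈ Finset.univ) => hd0 k
    positivity, fun p u q w => ?_⟩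
  have h1 : ∑ i, ‖p i + ∑ k, (L k i).adjoint (q k)‖ ^ 2 ≤
      ∑ i, 2 * (‖p i‖ ^ 2 + c i * ∑ k, ‖q k‖ ^ 2) :=
    Finset.sum_le_sum fun i _ => (norm_add_sq_le _ _).trans (by gcongr; exact hc i q)
  have h2 : ∑ k, ‖∑ i, L k i (u i) - w k‖ ^ 2 ≤
      ∑ k, 2 * (d k * ∑ i, ‖u i‖ ^ 2 + ‖w k‖ ^ 2) :=
    Finset.sum_le_sum fun k _ => by
      rw [sub_eq_add_neg]
      refine (norm_add_sq_le _ _).trans ?_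
      rw [norm_neg]
      gcongr
      exact hd k u
  rw [← Finset.mul_sum, Finset.sum_add_distrib, ← Finset.sum_mul] at h1 h2
  have hc' := Finset.sum_nonneg fun i (_ : i ∈ Finset.univ) => hc0 i
  have hd' := Finset.sum_nonneg fun k (_ : k ∈ Finset.univ) => hd0 k
  have e1 : 0 ≤ ∑ i, ‖p i‖ ^ 2 := by positivity
  have e2 : 0 ≤ ∑ k, ‖q k‖ ^ 2 := by positivity
  have e3 : 0 ≤ ∑ i, ‖u i‖ ^ 2 := by positivity
  have e4 : 0 ≤ ∑ k, ‖w k‖ ^ 2 := by positivity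
  unfold sqNorm
  generalize ∑ i, c i = c' at *
  generalize ∑ k, d k = d' at *
  nlinarith [mul_nonneg hc' e1, mul_nonneg hc' e3, mul_nonneg hc' e4, mul_nonneg hd' e1,
    mul_nonneg hd' e2, mul_nonneg hd' e4]

/-- Coercivity from `g ≥ ε`; Young's inequality spends half of it on the perturbation `r`. -/
theorem inner_smul_add_ge {V : Type*} [NormedAddCommGroup V] [InnerProductSpace ℝ V] {ε g : ℝ}
    (hε : 0 < ε) (hg : ε ≤ g) (u r : V) :
    ε / 2 * ‖u‖ ^ 2 - 1 / (2 * ε) * ‖r‖ ^ 2 ≤ inner ℝ u (g • u + r) := by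
  rw [inner_add_right, inner_smul_right, real_inner_self_eq_norm_sq]
  have h1 := neg_le_of_abs_le (abs_real_inner_le_norm u r)
  have h2 : ‖u‖ * ‖r‖ ≤ ε / 2 * ‖u‖ ^ 2 + 1 / (2 * ε) * ‖r‖ ^ 2 := by
    have h := sq_nonneg (ε * ‖u‖ - ‖r‖)
    have : ε / 2 * ‖u‖ ^ 2 + 1 / (2 * ε) * ‖r‖ ^ 2 - ‖u‖ * ‖r‖ =
        (ε * ‖u‖ - ‖r‖) ^ 2 / (2 * ε) := by field_simp; ring
    have : 0 ≤ (ε * ‖u‖ - ‖r‖) ^ 2 / (2 * ε) := by positivity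
    linarith
  have h3 : ε * ‖u‖ ^ 2 ≤ g * ‖u‖ ^ 2 := by gcongr
  linarith

theorem norm_smul_add_sq_le {V : Type*} [NormedAddCommGroup V] [InnerProductSpace ℝ V] {ε c : ℝ}
    (hε : 0 < ε) (hc : c ∈ Set.Icc ε (1 / ε)) (y z : V) :
    ‖c • y + z‖ ^ 2 ≤ 2 * ((1 / ε) ^ 2 * ‖y‖ ^ 2 + ‖z‖ ^ 2) := by
  refine (norm_add_sq_le _ _).trans ?_
  rw [norm_smul, mul_pow, Real.norm_eq_abs, sq_abs]
  have : 0 ≤ c := hε.le.trans hc.1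
  gcongr
  exact hc.2

/-- Residual estimate: `u`, `w` are controlled by the squared norm `D` of the step and by the
perturbations `r`, `q`. -/
theorem exists_sqNorm_residual_le (L : ∀ k i, H i →ₗ[ℝ] G k) {ε : ℝ} (hε : 0 < ε) :
    ∃ c : ℝ, 0 ≤ c ∧ ∀ (u r : ∀ i, H i) (w q : ∀ k, G k) (g : ι → ℝ) (m : κ → ℝ) (D : ℝ), 0 ≤ D →
      (∀ i, g i ∈ Set.Icc ε (1 / ε)) → (∀ k, m k ∈ Set.Icc ε (1 / ε)) →
      (∀ η : ℝ, 0 < η → ∑ i, inner ℝ (u i) (g i • u i + r i) +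
          ∑ k, inner ℝ (w k) (m k • w k + q k) ≤
        D / (2 * η) + η / 2 * sqNorm
          (fun i => (g i • u i + r i) + ∑ k, (L k i).adjoint (m k • w k + q k))
          (fun k => ∑ i, L k i (u i) - w k)) →
      sqNorm u w ≤ c * (D + sqNorm r q) := by
  obtain ⟨C, hC0, hC⟩ := exists_sqNorm_direction_le L
  -- `C'` bounds the squared norm of the direction by the residuals plus the perturbations; the `+
  -- 1` keeps it positive. Taking `η = ε / (2 * C')` makes the `η` term cost only `ε / 4` times that
  -- sum, half of the coercivity constant `ε / 2`, so it can be absorbed.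
  let C' := C * (2 * (1 / ε) ^ 2 + 3) + 1
  have hC' : 0 < C' := by positivity
  have hη : 0 < ε / (2 * C') := by positivity
  refine ⟨4 / ε * (C' / ε + 1 / (2 * ε) + ε / 4), by positivity,
    fun u r w q g m D hD hg hm h => ?_⟩
  have h1 : ε / 2 * sqNorm u w - 1 / (2 * ε) * sqNorm r q ≤
      ∑ i, inner ℝ (u i) (g i • u i + r i) + ∑ k, inner ℝ (w k) (m k • w k + q k) := by
    have e1 := Finset.sum_le_sum fun i (_ : i ∈ Finset.univ) =>
      inner_smul_add_ge hε (hg i).1 (u i) (r i)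
    have e2 := Finset.sum_le_sum fun k (_ : k ∈ Finset.univ) =>
      inner_smul_add_ge hε (hm k).1 (w k) (q k)
    simp only [Finset.sum_sub_distrib, ← Finset.mul_sum] at e1 e2
    simp only [sqNorm]
    linarith
  have h2 : sqNorm (fun i => g i • u i + r i) (fun k => m k • w k + q k) ≤
      2 * ((1 / ε) ^ 2 * sqNorm u w + sqNorm r q) := by
    have e1 := Finset.sum_le_sum fun i (_ : i ∈ Finset.univ) => norm_smul_add_sq_le hε (hg i) (u i) (r i)
    have e2 := Finset.sum_le_sum fun k (_ : k ∈ Finset.univ) => norm_smul_add_sq_le hε (hm k) (w k) (q k)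
    simp only [Finset.sum_add_distrib, ← Finset.mul_sum] at e1 e2
    simp only [sqNorm]
    linarith
  have h3 := hC (fun i => g i • u i + r i) u (fun k => m k • w k + q k) w
  have h4 := h _ hη
  set S := sqNorm (fun i => (g i • u i + r i) + ∑ k, (L k i).adjoint (m k • w k + q k))
          (fun k => ∑ i, L k i (u i) - w k)
  have hU := sqNorm_nonneg u w
  have hR := sqNorm_nonneg r q
  have h5 : S ≤ C' * (sqNorm u w + sqNorm r q) := by
    refine h3.trans ?_
    have : C * (sqNorm (fun i => g i • u i + r i) (fun k => m k • w k + q k) + sqNorm u w) ≤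
        C * (2 * ((1 / ε) ^ 2 * sqNorm u w + sqNorm r q) + sqNorm u w) := by gcongr
    refine this.trans ?_
    have e : C' * (sqNorm u w + sqNorm r q) -
        C * (2 * ((1 / ε) ^ 2 * sqNorm u w + sqNorm r q) + sqNorm u w) =
        C * (2 * sqNorm u w + (2 * (1 / ε) ^ 2 + 1) * sqNorm r q) +
          (sqNorm u w + sqNorm r q) := by simp only [C']; ring
    have : 0 ≤ C * (2 * sqNorm u w + (2 * (1 / ε) ^ 2 + 1) * sqNorm r q) := by positivity
    linarith
  have h6 : ε / (2 * C') / 2 * S ≤ ε / 4 * (sqNorm u w + sqNorm r q) := by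
    calc ε / (2 * C') / 2 * S ≤ ε / (2 * C') / 2 * (C' * (sqNorm u w + sqNorm r q)) := by gcongr
      _ = _ := by field_simp; ring
  have h7 : D / (2 * (ε / (2 * C'))) = C' / ε * D := by field_simp
  rw [h7] at h4
  have h8 : sqNorm u w = 4 / ε * (ε / 4 * sqNorm u w) := by field_simp
  rw [h8, mul_assoc]
  refine mul_le_mul_of_nonneg_left ?_ (by positivity)
  nlinarith [mul_nonneg hD (by positivity : 0 ≤ 1 / (2 * ε) + ε / 4),
    mul_nonneg hR (by positivity : 0 ≤ C' / ε)]

end Problem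

/-! ### Expansion of squared distances after a step. -/

section Step

variable {ι κ : Type*} [Fintype ι] [Fintype κ]
  {H : ι → Type*} [∀ i, NormedAddCommGroup (H i)] [∀ i, InnerProductSpace ℝ (H i)]
  {G : κ → Type*} [∀ k, NormedAddCommGroup (G k)] [∀ k, InnerProductSpace ℝ (G k)]

theorem sum_norm_sub_smul_sub_sq (x y d : ∀ i, H i) (c : ℝ) :
    ∑ i, ‖x i - c • d i - y i‖ ^ 2 =
      ∑ i, ‖x i - y i‖ ^ 2 - 2 * c * ∑ i, inner ℝ (x i - y i) (d i) + c ^ 2 * ∑ i, ‖d i‖ ^ 2 := by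
  rw [Finset.mul_sum, Finset.mul_sum, ← Finset.sum_sub_distrib, ← Finset.sum_add_distrib]
  refine Finset.sum_congr rfl fun i _ => ?_
  rw [show x i - c • d i - y i = (x i - y i) - c • d i by abel, norm_sub_sq_real, norm_smul,
    inner_smul_right, mul_pow, Real.norm_eq_abs, sq_abs]
  ring

theorem sqDist_sub_smul (x d : ∀ i, H i) (v e : ∀ k, G k) (z : (∀ i, H i) × (∀ k, G k)) (c : ℝ) :
    sqDist (fun i => x i - c • d i) (fun k => v k - c • e k) z =
      sqDist x v z - 2 * c * (∑ i, inner ℝ (x i - z.1 i) (d i) + ∑ k, inner ℝ (v k - z.2 k) (e k)) +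
        c ^ 2 * sqNorm d e := by
  simp only [sqDist, sqNorm, sum_norm_sub_smul_sub_sq]
  ring

theorem sqNorm_smul (c : ℝ) (d : ∀ i, H i) (e : ∀ k, G k) :
    sqNorm (fun i => c • d i) (fun k => c • e k) = c ^ 2 * sqNorm d e := by
  simp only [sqNorm, norm_smul, mul_pow, Real.norm_eq_abs, sq_abs, ← Finset.mul_sum]
  ring

end Step

/-! ### One iteration: separation and descent. -/

namespace IsTrajectory

variable {ι κ : Type*} [Fintype ι] [Fintype κ]
  {H : ι → Type*} [∀ i, NormedAddCommGroup (H i)] [∀ i, InnerProductSpace ℝ (H i)]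
  [∀ i, FiniteDimensional ℝ (H i)]
  {G : κ → Type*} [∀ k, NormedAddCommGroup (G k)] [∀ k, InnerProductSpace ℝ (G k)]
  [∀ k, FiniteDimensional ℝ (G k)]
  {A : ∀ i, H i → Set (H i)} {B : ∀ k, G k → Set (G k)}
  {L : ∀ k i, H i →ₗ[ℝ] G k} {γ : ℕ → ι → ℝ} {μ : ℕ → κ → ℝ}
  {I : ℕ → Set ι} {K : ℕ → Set κ} {lam : ℕ → ℝ}
  {x : ℕ → ∀ i, H i} {v : ℕ → ∀ k, G k}
  {a as : ℕ → ∀ i, H i} {b bs : ℕ → ∀ k, G k}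
  {ts : ℕ → ∀ i, H i} {t : ℕ → ∀ k, G k} {Δ θ : ℕ → ℝ}

/-- The pair `(a, as)` is carried over jointly, so graph membership and the defining formula
persist, the formula with the iterates of the activation time `s`. With `m = 0`, where all blocks
are active, this covers every `n`. -/
theorem exists_activation_primal (h : IsTrajectory A B L γ μ I K lam x v a as b bs ts t Δ θ)
    (hγ : ∀ n i, 0 < γ n i) {m n : ℕ} {i : ι} (hmn : m ≤ n) (hi : i ∈ I m) :
    ∃ s, m ≤ s ∧ s ≤ n ∧ as n i ∈ A i (a n i) ∧
      as n i = (γ s i)⁻¹ • (x s i - a n i) - ∑ k, (L k i).adjoint (v s k) := by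
  obtain ⟨s, h1, h2, h3, h4⟩ := exists_last_activation (f := fun n => (a n i, as n i))
    (fun n hn => Prod.ext (h.a_inactive n i hn) (h.as_inactive n i hn)) hmn hi
  obtain ⟨h5, h6⟩ := Prod.mk.inj h4
  refine ⟨s, h1, h2, ?_, ?_⟩
  · rw [h5, h6, h.as_active s i h3]
    have := inv_smul_sub_mem_of_mem_resolventOp (hγ s i).ne' (h.a_active s i h3)
    rwa [sub_right_comm, smul_sub, inv_smul_smul₀ (hγ s i).ne'] at this
  · rw [h5, h6, h.as_active s i h3]

theorem exists_activation_dual (h : IsTrajectory A B L γ μ I K lam x v a as b bs ts t Δ θ)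
    (hμ : ∀ n k, 0 < μ n k) {m n : ℕ} {k : κ} (hmn : m ≤ n) (hk : k ∈ K m) :
    ∃ s, m ≤ s ∧ s ≤ n ∧ bs n k ∈ B k (b n k) ∧
      bs n k = v s k + (μ s k)⁻¹ • (∑ i, L k i (x s i) - b n k) := by
  obtain ⟨s, h1, h2, h3, h4⟩ := exists_last_activation (f := fun n => (b n k, bs n k))
    (fun n hn => Prod.ext (h.b_inactive n k hn) (h.bs_inactive n k hn)) hmn hk
  obtain ⟨h5, h6⟩ := Prod.mk.inj h4
  refine ⟨s, h1, h2, ?_, ?_⟩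
  · rw [h5, h6, h.bs_active s k h3]
    have := inv_smul_sub_mem_of_mem_resolventOp (hμ s k).ne' (h.b_active s k h3)
    rwa [add_sub_right_comm, smul_add, inv_smul_smul₀ (hμ s k).ne', add_comm] at this
  · rw [h5, h6, h.bs_active s k h3]

/-- Form of `Δ` that exhibits the residuals: for blocks activated at time `n` the second factors are
`(γ n i)⁻¹` and `(μ n k)⁻¹` times the first, hence coercivity. -/
theorem Δ_eq_sum_inner (h : IsTrajectory A B L γ μ I K lam x v a as b bs ts t Δ θ) (n : ℕ) :
    Δ n = ∑ i, inner ℝ (x n i - a n i) (as n i + ∑ k, (L k i).adjoint (v n k)) +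
      ∑ k, inner ℝ (∑ i, L k i (x n i) - b n k) (bs n k - v n k) := by
  have e1 := sum_inner_sum_adjoint L (x n) (bs n)
  have e2 := sum_inner_sum_adjoint L (x n) (v n)
  have e3 := sum_inner_sum_adjoint L (a n) (v n)
  rw [h.Δ_eq]
  simp only [h.ts_eq, h.t_eq, inner_add_right, inner_sub_left, inner_sub_right,
    Finset.sum_add_distrib, Finset.sum_sub_distrib]
  linarith

/-- The right side minus `Δ n` is exactly the sum of the monotonicity products `h1` and `h2` of the
stored graph points against those given by `z`. -/
theorem Δ_le (h : IsTrajectory A B L γ μ I K lam x v a as b bs ts t Δ θ)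
    (hA : ∀ i, IsMaximallyMonotone (A i)) (hB : ∀ k, IsMaximallyMonotone (B k))
    (hγ : ∀ n i, 0 < γ n i) (hμ : ∀ n k, 0 < μ n k) (hI : I 0 = Set.univ) (hK : K 0 = Set.univ)
    {z : (∀ i, H i) × (∀ k, G k)} (hz : z ∈ kuhnTucker A B L) (n : ℕ) :
    Δ n ≤ ∑ i, inner ℝ (x n i - z.1 i) (ts n i) + ∑ k, inner ℝ (v n k - z.2 k) (t n k) := by
  have h1 : 0 ≤ ∑ i, inner ℝ (a n i - z.1 i) (as n i - -∑ k, (L k i).adjoint (z.2 k)) :=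
    Finset.sum_nonneg fun i _ => by
      obtain ⟨s, -, -, hs, -⟩ := h.exists_activation_primal hγ (n.zero_le) (i := i) (by simp [hI])
      exact (hA i).inner_nonneg hs (hz.1 i)
  have h2 : 0 ≤ ∑ k, inner ℝ (b n k - ∑ i, L k i (z.1 i)) (bs n k - z.2 k) :=
    Finset.sum_nonneg fun k _ => by
      obtain ⟨s, -, -, hs, -⟩ := h.exists_activation_dual hμ (n.zero_le) (k := k) (by simp [hK])
      exact (hB k).inner_nonneg hs (hz.2 k)
  have e1 := sum_inner_sum_adjoint L (z.1) (bs n)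
  have e2 := sum_inner_sum_adjoint L (z.1) (z.2)
  have e3 := sum_inner_sum_adjoint L (a n) (z.2)
  have e4 : ∀ (y : ∀ k, G k), ∑ k, inner ℝ (y k) (t n k) = ∑ k, inner ℝ (t n k) (y k) :=
    fun y => Finset.sum_congr rfl fun k _ => real_inner_comm _ _
  rw [e4 fun k => v n k - z.2 k, h.Δ_eq]
  simp only [h.ts_eq, h.t_eq, inner_add_right, inner_sub_left, inner_sub_right, sub_neg_eq_add,
    Finset.sum_add_distrib, Finset.sum_sub_distrib] at *
  linarith

/-- The squared norm of the direction `θ n • (ts n, t n)` is at most its inner product with the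
difference between the iterate and a Kuhn–Tucker point. -/
theorem sqNorm_direction_le_inner (h : IsTrajectory A B L γ μ I K lam x v a as b bs ts t Δ θ)
    (hA : ∀ i, IsMaximallyMonotone (A i)) (hB : ∀ k, IsMaximallyMonotone (B k))
    (hγ : ∀ n i, 0 < γ n i) (hμ : ∀ n k, 0 < μ n k) (hI : I 0 = Set.univ) (hK : K 0 = Set.univ)
    {z : (∀ i, H i) × (∀ k, G k)} (hz : z ∈ kuhnTucker A B L) (n : ℕ) :
    sqNorm (fun i => θ n • ts n i) (fun k => θ n • t n k) ≤
      ∑ i, inner ℝ (x n i - z.1 i) (θ n • ts n i) + ∑ k, inner ℝ (v n k - z.2 k) (θ n • t n k) := by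
  have h1 := h.Δ_le hA hB hγ hμ hI hK hz n
  rw [sqNorm_smul]
  simp only [inner_smul_right, ← Finset.mul_sum, ← mul_add]
  have h2 : θ n * sqNorm (ts n) (t n) ≤ max (Δ n) 0 ∧ 0 ≤ θ n ∧ (Δ n ≤ 0 → θ n = 0) := by
    have hθ := h.θ_eq n
    have hS := sqNorm_nonneg (ts n) (t n)
    by_cases hΔ : 0 < Δ n
    · rw [if_pos hΔ, if_neg hΔ.not_ge, add_zero] at hθ
      change θ n = Δ n / sqNorm (ts n) (t n) at hθ
      refine ⟨?_, by rw [hθ]; positivity, fun h => absurd hΔ h.not_gt⟩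
      rw [hθ]
      -- For a zero direction, division by zero sets `θ n = 0`.
      rcases hS.eq_or_lt with hS0 | hS0
      · simp [← hS0]
      · rw [div_mul_cancel₀ _ hS0.ne']
        exact le_max_left _ _
    · rw [if_neg hΔ, zero_div] at hθ
      simp [hθ]
  obtain ⟨h3, h4, h5⟩ := h2
  rcases le_or_gt (Δ n) 0 with hΔ | hΔ
  · simp [h5 hΔ]
  · rw [max_eq_left hΔ.le] at h3
    rw [pow_two, mul_assoc]
    exact mul_le_mul_of_nonneg_left (h3.trans h1) h4

/-- The unit step leaves a nonnegative squared distance, which is at most the old one minus the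
squared norm of the direction. This bound transfers integrability from the distance to the
direction. -/
theorem sqNorm_direction_le_sqDist (h : IsTrajectory A B L γ μ I K lam x v a as b bs ts t Δ θ)
    (hA : ∀ i, IsMaximallyMonotone (A i)) (hB : ∀ k, IsMaximallyMonotone (B k))
    (hγ : ∀ n i, 0 < γ n i) (hμ : ∀ n k, 0 < μ n k) (hI : I 0 = Set.univ) (hK : K 0 = Set.univ)
    {z : (∀ i, H i) × (∀ k, G k)} (hz : z ∈ kuhnTucker A B L) (n : ℕ) :
    sqNorm (fun i => θ n • ts n i) (fun k => θ n • t n k) ≤ sqDist (x n) (v n) z := by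
  have h1 := h.sqNorm_direction_le_inner hA hB hγ hμ hI hK hz n
  have h2 := sqDist_sub_smul (x n) (fun i => θ n • ts n i) (v n) (fun k => θ n • t n k) z 1
  have h3 := sqDist_nonneg (fun i => x n i - (1 : ℝ) • θ n • ts n i)
    (fun k => v n k - (1 : ℝ) • θ n • t n k) z
  linarith

/-- Only `0 ≤ lam n` is needed, to multiply the projection inequality; overrelaxation beyond `2` is
allowed and may increase the distance. -/
theorem sqDist_succ_le (h : IsTrajectory A B L γ μ I K lam x v a as b bs ts t Δ θ)
    (hA : ∀ i, IsMaximallyMonotone (A i)) (hB : ∀ k, IsMaximallyMonotone (B k))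
    (hγ : ∀ n i, 0 < γ n i) (hμ : ∀ n k, 0 < μ n k) (hI : I 0 = Set.univ) (hK : K 0 = Set.univ)
    {z : (∀ i, H i) × (∀ k, G k)} (hz : z ∈ kuhnTucker A B L) {n : ℕ} (hlam : 0 ≤ lam n) :
    sqDist (x (n + 1)) (v (n + 1)) z ≤ sqDist (x n) (v n) z -
      lam n * (2 - lam n) * sqNorm (fun i => θ n • ts n i) (fun k => θ n • t n k) := by
  have h1 := h.sqNorm_direction_le_inner hA hB hγ hμ hI hK hz n
  have h2 := sqDist_sub_smul (x n) (fun i => θ n • ts n i) (v n) (fun k => θ n • t n k) z (lam n)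
  have ex : (fun i => x n i - lam n • θ n • ts n i) = x (n + 1) :=
    funext fun i => by rw [h.x_succ, smul_smul]
  have ev : (fun k => v n k - lam n • θ n • t n k) = v (n + 1) :=
    funext fun k => by rw [h.v_succ, smul_smul]
  rw [ex, ev] at h2
  nlinarith [mul_le_mul_of_nonneg_left h1 hlam]

/-- If `Δ n > 0`, then `Δ n = θ S` and the squared norm of the direction is `θ ^ 2 * S`, with `S`
that of `(ts, t)`; the gap is `S * (θ - η) ^ 2 / (2 * η)`. The free `η` permits the absorption in
`exists_sqNorm_residual_le`. -/
theorem Δ_le_sqNorm_direction (h : IsTrajectory A B L γ μ I K lam x v a as b bs ts t Δ θ)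
    (hA : ∀ i, IsMaximallyMonotone (A i)) (hB : ∀ k, IsMaximallyMonotone (B k))
    (hγ : ∀ n i, 0 < γ n i) (hμ : ∀ n k, 0 < μ n k) (hI : I 0 = Set.univ) (hK : K 0 = Set.univ)
    {z : (∀ i, H i) × (∀ k, G k)} (hz : z ∈ kuhnTucker A B L) (n : ℕ) {η : ℝ} (hη : 0 < η) :
    Δ n ≤ sqNorm (fun i => θ n • ts n i) (fun k => θ n • t n k) / (2 * η) +
      η / 2 * sqNorm (ts n) (t n) := by
  have hS := sqNorm_nonneg (ts n) (t n)
  have hD := sqNorm_nonneg (fun i => θ n • ts n i) (fun k => θ n • t n k)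
  rcases le_or_gt (Δ n) 0 with hΔ | hΔ
  · exact hΔ.trans (by positivity)
  have hθ := h.θ_eq n
  rw [if_pos hΔ, if_neg hΔ.not_ge, add_zero] at hθ
  change θ n = Δ n / sqNorm (ts n) (t n) at hθ
  rcases hS.eq_or_lt with hS0 | hS0
  -- With `ts` and `t` both zero, `Δ_le` at a Kuhn–Tucker point forces `Δ n ≤ 0`.
  · exfalso
    have e1 : ∀ i, ts n i = 0 := fun i => by
      have := norm_fst_sq_le_sqNorm (ts n) (t n) i
      rw [← hS0] at this
      simpa using le_antisymm this (by positivity)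
    have e2 : ∀ k, t n k = 0 := fun k => by
      have := norm_snd_sq_le_sqNorm (ts n) (t n) k
      rw [← hS0] at this
      simpa using le_antisymm this (by positivity)
    have := h.Δ_le hA hB hγ hμ hI hK hz n
    simp only [e1, e2, inner_zero_right, Finset.sum_const_zero, add_zero] at this
    linarith
  · have e : Δ n = θ n * sqNorm (ts n) (t n) := by rw [hθ]; field_simp
    rw [sqNorm_smul, e]
    have : θ n ^ 2 * sqNorm (ts n) (t n) / (2 * η) + η / 2 * sqNorm (ts n) (t n) -
        θ n * sqNorm (ts n) (t n) = sqNorm (ts n) (t n) * (θ n - η) ^ 2 / (2 * η) := by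
      field_simp; ring
    have : 0 ≤ sqNorm (ts n) (t n) * (θ n - η) ^ 2 / (2 * η) := by positivity
    linarith

end IsTrajectory

/-! ### Pathwise asymptotics: cluster points and convergence. -/

theorem tendsto_zero_of_norm_sq_le {V : Type*} [SeminormedAddCommGroup V] {f : ℕ → V} {g : ℕ → ℝ}
    (h : ∀ n, ‖f n‖ ^ 2 ≤ g n) (hg : Tendsto g atTop (𝓝 0)) : Tendsto f atTop (𝓝 0) := by
  rw [tendsto_zero_iff_norm_tendsto_zero]
  have h1 : Tendsto (fun n => Real.sqrt (g n)) atTop (𝓝 0) := by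
    simpa using hg.sqrt
  exact squeeze_zero (fun n => norm_nonneg _) (fun n => Real.le_sqrt_of_sq_le (h n)) h1

theorem tendsto_smul_zero_of_mem_Icc {V : Type*} [NormedAddCommGroup V] [NormedSpace ℝ V] {ε : ℝ}
    (hε : 0 < ε) {c : ℕ → ℝ} (hc : ∀ n, c n ∈ Set.Icc ε (1 / ε)) {f : ℕ → V}
    (hf : Tendsto f atTop (𝓝 0)) : Tendsto (fun n => c n • f n) atTop (𝓝 0) := by
  refine squeeze_zero_norm (a := fun n => 1 / ε * ‖f n‖) (fun n => ?_) ?_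
  · rw [norm_smul, Real.norm_eq_abs, abs_of_nonneg (hε.le.trans (hc n).1)]
    gcongr
    exact (hc n).2
  · simpa using hf.norm.const_mul (1 / ε)

theorem tendsto_linearMap_apply {V W : Type*} [NormedAddCommGroup V] [NormedSpace ℝ V]
    [FiniteDimensional ℝ V] [NormedAddCommGroup W] [NormedSpace ℝ W] (T : V →ₗ[ℝ] W)
    {f : ℕ → V} {y : V} (hf : Tendsto f atTop (𝓝 y)) :
    Tendsto (fun n => T (f n)) atTop (𝓝 (T y)) :=
  (T.continuous_of_finiteDimensional.tendsto _).comp hf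

theorem inv_mem_Icc {ε c : ℝ} (hε : 0 < ε) (hc : c ∈ Set.Icc ε (1 / ε)) :
    c⁻¹ ∈ Set.Icc ε (1 / ε) := by
  have hc0 := hε.trans_le hc.1
  constructor
  · rw [le_inv_comm₀ hε hc0, ← one_div]
    exact hc.2
  · rw [one_div]
    exact inv_anti₀ hε hc.1

namespace IsTrajectory

variable {ι κ : Type*} [Fintype ι] [Fintype κ]
  {H : ι → Type*} [∀ i, NormedAddCommGroup (H i)] [∀ i, InnerProductSpace ℝ (H i)]
  [∀ i, FiniteDimensional ℝ (H i)]
  {G : κ → Type*} [∀ k, NormedAddCommGroup (G k)] [∀ k, InnerProductSpace ℝ (G k)]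
  [∀ k, FiniteDimensional ℝ (G k)]
  {A : ∀ i, H i → Set (H i)} {B : ∀ k, G k → Set (G k)}
  {L : ∀ k i, H i →ₗ[ℝ] G k} {γ : ℕ → ι → ℝ} {μ : ℕ → κ → ℝ}
  {I : ℕ → Set ι} {K : ℕ → Set κ} {lam : ℕ → ℝ}
  {x : ℕ → ∀ i, H i} {v : ℕ → ∀ k, G k}
  {a as : ℕ → ∀ i, H i} {b bs : ℕ → ∀ k, G k}
  {ts : ℕ → ∀ i, H i} {t : ℕ → ∀ k, G k} {Δ θ : ℕ → ℝ}

/-- If the directions vanish along a trajectory, a limit of the iterates along times at which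
all the blocks have recently been activated is a Kuhn–Tucker point. -/
theorem mem_kuhnTucker_of_tendsto (h : IsTrajectory A B L γ μ I K lam x v a as b bs ts t Δ θ)
    (hA : ∀ i, IsMaximallyMonotone (A i)) (hB : ∀ k, IsMaximallyMonotone (B k))
    {ε : ℝ} (hε : 0 < ε) (hγ : ∀ n i, γ n i ∈ Set.Icc ε (1 / ε))
    (hμ : ∀ n k, μ n k ∈ Set.Icc ε (1 / ε)) (hI : I 0 = Set.univ) (hK : K 0 = Set.univ)
    (hne : (kuhnTucker A B L).Nonempty) {ρ : ℝ} (hlam : ∀ n, |lam n| ≤ ρ)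
    (hD : Tendsto (fun n => sqNorm (fun i => θ n • ts n i) (fun k => θ n • t n k)) atTop (𝓝 0))
    {φ : ℕ → ℕ} (hφ : Tendsto φ atTop atTop) {M : ℕ}
    (hφI : ∀ n i, ∃ j, j ≤ φ n ∧ φ n ≤ j + M ∧ i ∈ I j)
    (hφK : ∀ n k, ∃ j, j ≤ φ n ∧ φ n ≤ j + M ∧ k ∈ K j)
    {z : (∀ i, H i) × (∀ k, G k)} (hx : ∀ i, Tendsto (fun n => x (φ n) i) atTop (𝓝 (z.1 i)))
    (hv : ∀ k, Tendsto (fun n => v (φ n) k) atTop (𝓝 (z.2 k))) : z ∈ kuhnTucker A B L := by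
  have hγ0 : ∀ n i, 0 < γ n i := fun n i => hε.trans_le (hγ n i).1
  have hμ0 : ∀ n k, 0 < μ n k := fun n k => hε.trans_le (hμ n k).1
  obtain ⟨w, hw⟩ := hne
  have hρ : 0 ≤ ρ := (abs_nonneg _).trans (hlam 0)
  have hδ : Tendsto (fun n => ρ * Real.sqrt (sqNorm (fun i => θ n • ts n i)
      (fun k => θ n • t n k))) atTop (𝓝 0) := by
    simpa using hD.sqrt.const_mul ρ
  have hxd : ∀ i n, ‖x (n + 1) i - x n i‖ ≤ ρ * Real.sqrt (sqNorm (fun i => θ n • ts n i)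
      (fun k => θ n • t n k)) := fun i n => by
    rw [h.x_succ, sub_sub_cancel_left, norm_neg, ← smul_smul, norm_smul]
    exact mul_le_mul (hlam n) (Real.le_sqrt_of_sq_le
      (norm_fst_sq_le_sqNorm (fun i => θ n • ts n i) (fun k => θ n • t n k) i))
      (norm_nonneg _) hρ
  have hvd : ∀ k n, ‖v (n + 1) k - v n k‖ ≤ ρ * Real.sqrt (sqNorm (fun i => θ n • ts n i)
      (fun k => θ n • t n k)) := fun k n => by
    rw [h.v_succ, sub_sub_cancel_left, norm_neg, ← smul_smul, norm_smul]
    exact mul_le_mul (hlam n) (Real.le_sqrt_of_sq_le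
      (norm_snd_sq_le_sqNorm (fun i => θ n • ts n i) (fun k => θ n • t n k) k))
      (norm_nonneg _) hρ
  have hactI : ∀ n i, ∃ s, s ≤ φ n ∧ φ n ≤ s + M ∧ as (φ n) i ∈ A i (a (φ n) i) ∧
      as (φ n) i = (γ s i)⁻¹ • (x s i - a (φ n) i) - ∑ k, (L k i).adjoint (v s k) := by
    intro n i
    obtain ⟨j, hj1, hj2, hj3⟩ := hφI n i
    obtain ⟨s, h1, h2, h3⟩ := h.exists_activation_primal hγ0 hj1 hj3
    exact ⟨s, h2, by omega, h3⟩
  have hactK : ∀ n k, ∃ s, s ≤ φ n ∧ φ n ≤ s + M ∧ bs (φ n) k ∈ B k (b (φ n) k) ∧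
      bs (φ n) k = v s k + (μ s k)⁻¹ • (∑ i, L k i (x s i) - b (φ n) k) := by
    intro n k
    obtain ⟨j, hj1, hj2, hj3⟩ := hφK n k
    obtain ⟨s, h1, h2, h3⟩ := h.exists_activation_dual hμ0 hj1 hj3
    exact ⟨s, h2, by omega, h3⟩
  choose s hs1 hs2 hs3 hs4 using hactI
  choose σ hσ1 hσ2 hσ3 hσ4 using hactK
  have hxs : ∀ i, Tendsto (fun n => x (s n i) i - x (φ n) i) atTop (𝓝 0) := fun i =>
    tendsto_sub_of_bounded_gap (z := fun n => x n i) (hxd i) hδ hφ (fun n => hs1 n i) (fun n => hs2 n i)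
  have hvs : ∀ i k, Tendsto (fun n => v (s n i) k - v (φ n) k) atTop (𝓝 0) := fun i k =>
    tendsto_sub_of_bounded_gap (z := fun n => v n k) (hvd k) hδ hφ (fun n => hs1 n i) (fun n => hs2 n i)
  have hxσ : ∀ k i, Tendsto (fun n => x (σ n k) i - x (φ n) i) atTop (𝓝 0) := fun k i =>
    tendsto_sub_of_bounded_gap (z := fun n => x n i) (hxd i) hδ hφ (fun n => hσ1 n k) (fun n => hσ2 n k)
  have hvσ : ∀ k, Tendsto (fun n => v (σ n k) k - v (φ n) k) atTop (𝓝 0) := fun k =>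
    tendsto_sub_of_bounded_gap (z := fun n => v n k) (hvd k) hδ hφ (fun n => hσ1 n k) (fun n => hσ2 n k)
  -- `u` and `y` are the residuals at time `φ n`; `r` and `q` collect the errors due to activations
  -- at the earlier times `s n i` and `σ n k`.
  let u : ℕ → ∀ i, H i := fun n i => x (φ n) i - a (φ n) i
  let y : ℕ → ∀ k, G k := fun n k => ∑ i, L k i (x (φ n) i) - b (φ n) k
  let r : ℕ → ∀ i, H i := fun n i => (γ (s n i) i)⁻¹ • (x (s n i) i - x (φ n) i) -
    ∑ k, (L k i).adjoint (v (s n i) k - v (φ n) k)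
  let q : ℕ → ∀ k, G k := fun n k => (v (σ n k) k - v (φ n) k) +
    (μ (σ n k) k)⁻¹ • ∑ i, L k i (x (σ n k) i - x (φ n) i)
  have hr : ∀ i, Tendsto (fun n => r n i) atTop (𝓝 0) := fun i => by
    have e1 := tendsto_smul_zero_of_mem_Icc hε (fun n => inv_mem_Icc hε (hγ (s n i) i)) (hxs i)
    have e2 := tendsto_finsetSum Finset.univ fun k _ => tendsto_linearMap_apply (L k i).adjoint (hvs i k)
    simpa [r] using e1.sub e2
  have hq : ∀ k, Tendsto (fun n => q n k) atTop (𝓝 0) := fun k => by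
    have e2 := tendsto_finsetSum Finset.univ fun i _ => tendsto_linearMap_apply (L k i) (hxσ k i)
    simp only [map_zero, Finset.sum_const_zero] at e2
    have e1 := tendsto_smul_zero_of_mem_Icc hε (fun n => inv_mem_Icc hε (hμ (σ n k) k)) e2
    simpa [q] using (hvσ k).add e1
  have hur : ∀ n i, (γ (s n i) i)⁻¹ • u n i + r n i =
      as (φ n) i + ∑ k, (L k i).adjoint (v (φ n) k) := fun n i => by
    simp only [u, r, hs4, map_sub, Finset.sum_sub_distrib, smul_sub]
    abel
  have hyq : ∀ n k, (μ (σ n k) k)⁻¹ • y n k + q n k = bs (φ n) k - v (φ n) k := fun n k => by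
    simp only [y, q, hσ4, map_sub, Finset.sum_sub_distrib, smul_sub]
    abel
  obtain ⟨c, hc0, hc⟩ := exists_sqNorm_residual_le L hε
  have hbound : ∀ n, sqNorm (u n) (y n) ≤ c * (sqNorm (fun i => θ (φ n) • ts (φ n) i)
      (fun k => θ (φ n) • t (φ n) k) + sqNorm (r n) (q n)) := fun n => by
    refine hc (u n) (r n) (y n) (q n) (fun i => (γ (s n i) i)⁻¹) (fun k => (μ (σ n k) k)⁻¹) _
      (sqNorm_nonneg _ _) (fun i => inv_mem_Icc hε (hγ _ i)) (fun k => inv_mem_Icc hε (hμ _ k))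
      fun η hη => ?_
    have e := h.Δ_le_sqNorm_direction hA hB hγ0 hμ0 hI hK hw (φ n) hη
    rw [h.Δ_eq_sum_inner] at e
    simp only [hur, hyq]
    convert e using 4
    · funext i
      rw [h.ts_eq]
      simp only [map_sub, Finset.sum_sub_distrib]
      abel
    · funext k
      rw [h.t_eq]
      simp only [u, y, map_sub, Finset.sum_sub_distrib]
      abel
  have hR : Tendsto (fun n => sqNorm (r n) (q n)) atTop (𝓝 0) := by
    have e1 := tendsto_finsetSum Finset.univ fun i _ => (hr i).norm.pow 2
    have e2 := tendsto_finsetSum Finset.univ fun k _ => (hq k).norm.pow 2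
    simpa [sqNorm] using e1.add e2
  have hU : Tendsto (fun n => c * (sqNorm (fun i => θ (φ n) • ts (φ n) i)
      (fun k => θ (φ n) • t (φ n) k) + sqNorm (r n) (q n))) atTop (𝓝 0) := by
    simpa using ((hD.comp hφ).add hR).const_mul c
  have hu : ∀ i, Tendsto (fun n => u n i) atTop (𝓝 0) := fun i =>
    tendsto_zero_of_norm_sq_le (fun n => (norm_fst_sq_le_sqNorm _ _ i).trans (hbound n)) hU
  have hy : ∀ k, Tendsto (fun n => y n k) atTop (𝓝 0) := fun k =>
    tendsto_zero_of_norm_sq_le (fun n => (norm_snd_sq_le_sqNorm _ _ k).trans (hbound n)) hU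
  refine ⟨fun i => ?_, fun k => ?_⟩
  · refine (hA i).mem_of_tendsto (fun n => hs3 n i) (x := z.1 i) ?_ ?_
    · simpa [u] using (hx i).sub (hu i)
    · have e1 := tendsto_smul_zero_of_mem_Icc hε (fun n => inv_mem_Icc hε (hγ (s n i) i)) (hu i)
      have e2 := tendsto_finsetSum Finset.univ fun k _ => tendsto_linearMap_apply (L k i).adjoint (hv k)
      have e3 := (e1.add (hr i)).sub e2
      simp only [hur] at e3
      simpa using e3
  · have e2 := tendsto_finsetSum Finset.univ fun i _ => tendsto_linearMap_apply (L k i) (hx i)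
    refine (hB k).mem_of_tendsto (fun n => hσ3 n k) (x := ∑ i, L k i (z.1 i)) ?_ ?_
    · simpa [y] using e2.sub (hy k)
    · have e1 := tendsto_smul_zero_of_mem_Icc hε (fun n => inv_mem_Icc hε (hμ (σ n k) k)) (hy k)
      have e3 := (e1.add (hq k)).add (hv k)
      simp only [hyq] at e3
      simpa using e3

/-- Pathwise convergence of the iterates. -/
theorem exists_mem_kuhnTucker_tendsto
    (h : IsTrajectory A B L γ μ I K lam x v a as b bs ts t Δ θ)
    (hA : ∀ i, IsMaximallyMonotone (A i)) (hB : ∀ k, IsMaximallyMonotone (B k))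
    {ε : ℝ} (hε : 0 < ε) (hγ : ∀ n i, γ n i ∈ Set.Icc ε (1 / ε))
    (hμ : ∀ n k, μ n k ∈ Set.Icc ε (1 / ε)) (hI : I 0 = Set.univ) (hK : K 0 = Set.univ)
    (hne : (kuhnTucker A B L).Nonempty) {ρ : ℝ} (hlam : ∀ n, lam n ∈ Set.Icc ε ρ)
    (hD : Summable fun n => sqNorm (fun i => θ n • ts n i) (fun k => θ n • t n k)) {M : ℕ}
    (hfreq : ∃ᶠ n in atTop, (∀ i, ∃ j, j ≤ n ∧ n ≤ j + M ∧ i ∈ I j) ∧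
      ∀ k, ∃ j, j ≤ n ∧ n ≤ j + M ∧ k ∈ K j) :
    ∃ z ∈ kuhnTucker A B L, (∀ i, Tendsto (fun n => x n i) atTop (𝓝 (z.1 i))) ∧
      ∀ k, Tendsto (fun n => v n k) atTop (𝓝 (z.2 k)) := by
  have hγ0 : ∀ n i, 0 < γ n i := fun n i => hε.trans_le (hγ n i).1
  have hμ0 : ∀ n k, 0 < μ n k := fun n k => hε.trans_le (hμ n k).1
  have hlam0 : ∀ n, 0 ≤ lam n := fun n => hε.le.trans (hlam n).1
  have hconv : ∀ z ∈ kuhnTucker A B L,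
      ∃ l, Tendsto (fun n => sqDist (x n) (v n) z) atTop (𝓝 l) := fun z hz => by
    refine exists_tendsto_of_le_add_summable (fun n => sqDist_nonneg _ _ _)
      (hD.mul_left (ρ ^ 2)) (fun n => mul_nonneg (sq_nonneg _) (sqNorm_nonneg _ _)) fun n => ?_
    have h1 := h.sqDist_succ_le hA hB hγ0 hμ0 hI hK hz (hlam0 n)
    -- A relaxation above `2` costs at most `ρ ^ 2` times the squared direction, which is summable.
    have h2 : -(ρ ^ 2) ≤ lam n * (2 - lam n) := by
      nlinarith [pow_le_pow_left₀ (hlam0 n) (hlam n).2 2, hlam0 n]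
    have h3 := mul_le_mul_of_nonneg_right h2
      (sqNorm_nonneg (fun i => θ n • ts n i) (fun k => θ n • t n k))
    linarith
  obtain ⟨φ, hφ, hφP⟩ := extraction_of_frequently_atTop hfreq
  obtain ⟨w, hw⟩ := id hne
  obtain ⟨l, hl⟩ := hconv w hw
  obtain ⟨R, hR⟩ := hl.bddAbove_range
  have hR' : ∀ n, sqDist (x n) (v n) w ≤ R := fun n => hR ⟨n, rfl⟩
  have hball : ∀ n, (x (φ n), v (φ n)) ∈ Metric.closedBall w (Real.sqrt R) := fun n => by
    rw [Metric.mem_closedBall, dist_eq_norm]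
    refine max_le ?_ ?_
    · refine (pi_norm_le_iff_of_nonneg (Real.sqrt_nonneg _)).2 fun i => ?_
      exact Real.le_sqrt_of_sq_le ((norm_fst_sq_le_sqNorm (fun i => x (φ n) i - w.1 i)
        (fun k => v (φ n) k - w.2 k) i).trans (hR' (φ n)))
    · refine (pi_norm_le_iff_of_nonneg (Real.sqrt_nonneg _)).2 fun k => ?_
      exact Real.le_sqrt_of_sq_le ((norm_snd_sq_le_sqNorm (fun i => x (φ n) i - w.1 i)
        (fun k => v (φ n) k - w.2 k) k).trans (hR' (φ n)))
  obtain ⟨z, -, ψ, hψ, hz⟩ := (isCompact_closedBall w (Real.sqrt R)).tendsto_subseq hball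
  have hzx : ∀ i, Tendsto (fun n => x (φ (ψ n)) i) atTop (𝓝 (z.1 i)) :=
    tendsto_pi_nhds.1 ((continuous_fst.tendsto z).comp hz)
  have hzv : ∀ k, Tendsto (fun n => v (φ (ψ n)) k) atTop (𝓝 (z.2 k)) :=
    tendsto_pi_nhds.1 ((continuous_snd.tendsto z).comp hz)
  have hφψ : Tendsto (fun n => φ (ψ n)) atTop atTop := hφ.tendsto_atTop.comp hψ.tendsto_atTop
  have hzmem : z ∈ kuhnTucker A B L :=
    h.mem_kuhnTucker_of_tendsto hA hB hε hγ hμ hI hK hne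
      (fun n => (abs_of_nonneg (hlam0 n)).trans_le (hlam n).2) hD.tendsto_atTop_zero hφψ
      (fun n => (hφP (ψ n)).1) (fun n => (hφP (ψ n)).2) hzx hzv
  obtain ⟨l', hl'⟩ := hconv z hzmem
  have hsub : Tendsto (fun n => sqDist (x (φ (ψ n))) (v (φ (ψ n))) z) atTop (𝓝 0) := by
    have e1 := tendsto_finsetSum Finset.univ fun i _ => ((hzx i).sub_const (z.1 i)).norm.pow 2
    have e2 := tendsto_finsetSum Finset.univ fun k _ => ((hzv k).sub_const (z.2 k)).norm.pow 2
    simpa [sqDist] using e1.add e2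
  -- The distance to `z` converges along the full sequence and vanishes along a subsequence, so its
  -- limit is zero.
  rw [tendsto_nhds_unique (hl'.comp hφψ) hsub] at hl'
  refine ⟨z, hzmem, fun i => tendsto_sub_nhds_zero_iff.1 ?_, fun k => tendsto_sub_nhds_zero_iff.1 ?_⟩
  · exact tendsto_zero_of_norm_sq_le (fun n => norm_fst_sq_le_sqNorm (fun i => x n i - z.1 i)
      (fun k => v n k - z.2 k) i) hl'
  · exact tendsto_zero_of_norm_sq_le (fun n => norm_snd_sq_le_sqNorm (fun i => x n i - z.1 i)
      (fun k => v n k - z.2 k) k) hl'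

end IsTrajectory

/-! ### Random activation of the blocks. -/

section Blocks

variable {Ω ι : Type*} [MeasurableSpace Ω] {P : Measure Ω} {N : ℕ} {p : ι → ℝ}
  {I : ℕ → Ω → Set ι}

/-- Independence passes to complements; the shift `m + 1` is there because it is assumed from time
`1` on only. -/
theorem IsBlockSelection.measure_biInter_compl [IsProbabilityMeasure P]
    (h : IsBlockSelection P N p I) (i : ι) (s : Finset ℕ) :
    P (⋂ m ∈ s, {ω | i ∈ I (m + 1) ω}ᶜ) = ∏ m ∈ s, P {ω | i ∈ I (m + 1) ω}ᶜ := by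
  have hind : iIndepSet (fun m => {ω | i ∈ I (m + 1) ω}) P := by
    refine (iIndepSet_iff_meas_biInter fun m => h.measurableSet_mem _ _).2 fun s => ?_
    have := h.prod_eq i (s.map (addRightEmbedding 1)) (by simp)
    simpa using this
  exact (iIndepSet_iff _ _).1 hind s fun m _ =>
    (MeasurableSpace.measurableSet_generateFrom (Set.mem_singleton _)).compl

/-- Cut the times after `n` into `m` windows of length `N`: each is missed with probability at most
`1 - p i`, and independence in time multiplies these bounds. -/
theorem IsBlockSelection.measure_forall_notMem_le [IsProbabilityMeasure P]
    (h : IsBlockSelection P N p I) (i : ι) (n m : ℕ) :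
    P {ω | ∀ j, n < j → j ≤ n + m * N → i ∉ I j ω} ≤ ENNReal.ofReal (1 - p i) ^ m := by
  have hwin : ∀ n, ∏ j ∈ Finset.Ico n (n + N), P {ω | i ∈ I (j + 1) ω}ᶜ ≤
      ENNReal.ofReal (1 - p i) := fun n => by
    rw [← h.measure_biInter_compl]
    have hmeas : MeasurableSet {ω | i ∈ ⋃ j ∈ Finset.Ico (n + 1) (n + 1 + N), I j ω} := by
      have : {ω | i ∈ ⋃ j ∈ Finset.Ico (n + 1) (n + 1 + N), I j ω} =
          ⋃ j ∈ Finset.Ico (n + 1) (n + 1 + N), {ω | i ∈ I j ω} := by ext; simp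
      rw [this]
      exact Finset.measurableSet_biUnion _ fun j _ => h.measurableSet_mem j i
    have hsub : (⋂ j ∈ Finset.Ico n (n + N), {ω | i ∈ I (j + 1) ω}ᶜ) ⊆
        {ω | i ∈ ⋃ j ∈ Finset.Ico (n + 1) (n + 1 + N), I j ω}ᶜ := by
      intro ω hω hmem
      simp only [Set.mem_ofPred_eq, Set.mem_iUnion, Finset.mem_Ico, exists_prop] at hmem
      obtain ⟨j, ⟨hj1, hj2⟩, hj⟩ := hmem
      obtain ⟨k, rfl⟩ : ∃ k, j = k + 1 := ⟨j - 1, by omega⟩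
      exact Set.mem_iInter₂.1 hω k (Finset.mem_Ico.2 ⟨by omega, by omega⟩) hj
    refine (measure_mono hsub).trans ?_
    rw [← ofReal_measureReal, probReal_compl_eq_one_sub hmeas]
    exact ENNReal.ofReal_le_ofReal (by linarith [h.le_prob (n + 1) i])
  have hprod : ∀ m, ∏ j ∈ Finset.Ico n (n + m * N), P {ω | i ∈ I (j + 1) ω}ᶜ ≤
      ENNReal.ofReal (1 - p i) ^ m := fun m => by
    induction m with
    | zero => simp
    | succ m ih =>
      rw [Nat.succ_mul, ← add_assoc, ← Finset.prod_Ico_consecutive _ (Nat.le_add_right n (m * N))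
        (Nat.le_add_right _ N), pow_succ]
      exact mul_le_mul' ih (hwin _)
  refine (measure_mono ?_).trans ((h.measure_biInter_compl i _).trans_le (hprod m))
  intro ω hω
  simp only [Set.mem_iInter, Finset.mem_Ico]
  exact fun j hj => hω (j + 1) (by omega) (by omega)

/-- A union bound, so different blocks may depend on one another. -/
theorem IsBlockSelection.measure_exists_forall_notMem_le [IsProbabilityMeasure P] [Fintype ι]
    (h : IsBlockSelection P N p I) (n m : ℕ) :
    P {ω | ∃ i, ∀ j, n < j → j ≤ n + m * N → i ∉ I j ω} ≤ ∑ i, ENNReal.ofReal (1 - p i) ^ m := by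
  rw [show {ω | ∃ i, ∀ j, n < j → j ≤ n + m * N → i ∉ I j ω} =
    ⋃ i, {ω | ∀ j, n < j → j ≤ n + m * N → i ∉ I j ω} by ext; simp]
  exact (measure_iUnion_fintype_le _ _).trans
    (Finset.sum_le_sum fun i _ => h.measure_forall_notMem_le i n m)

theorem IsBlockSelection.tendsto_sum_pow [Fintype ι] (h : IsBlockSelection P N p I) :
    Tendsto (fun m => ∑ i, ENNReal.ofReal (1 - p i) ^ m) atTop (𝓝 0) := by
  have := tendsto_finsetSum Finset.univ fun i _ =>
    ENNReal.tendsto_pow_atTop_nhds_zero_of_lt_one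
      (show ENNReal.ofReal (1 - p i) < 1 by
        rw [ENNReal.ofReal_lt_one]; linarith [(h.p_mem i).1])
  simpa using this

/-- On the exceptional set, for every `m`, the events `E m n` hold for all large `n`. Continuity
from below bounds the probability of this by `q m`; no independence between windows is used. -/
theorem ae_exists_frequently_notMem {E : ℕ → ℕ → Set Ω} {q : ℕ → ENNReal}
    (hE : ∀ m n, P (E m n) ≤ q m) (hq : Tendsto q atTop (𝓝 0)) :
    ∀ᵐ ω ∂P, ∃ m, ∃ᶠ n in atTop, ω ∉ E m n := by
  rw [ae_iff]
  refine le_antisymm (ge_of_tendsto' hq fun m => ?_) zero_le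
  have hsub : {ω | ¬∃ m, ∃ᶠ n in atTop, ω ∉ E m n} ⊆ ⋃ k, ⋂ n ≥ k, E m n := by
    intro ω hω
    simp only [Set.mem_ofPred_eq, not_exists, not_frequently, not_not] at hω
    obtain ⟨k, hk⟩ := eventually_atTop.1 (hω m)
    exact Set.mem_iUnion.2 ⟨k, Set.mem_iInter₂.2 hk⟩
  have hmono : Monotone fun k => ⋂ n ≥ k, E m n := fun k l hkl =>
    Set.biInter_subset_biInter_left fun n (hn : l ≤ n) => hkl.trans hn
  refine (measure_mono hsub).trans ?_
  rw [hmono.measure_iUnion]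
  exact iSup_le fun k => (measure_mono (Set.biInter_subset_of_mem (le_refl k))).trans (hE m k)

/-- Almost surely, for some `M`, infinitely many windows of length `M` activate all the blocks. -/
theorem ae_exists_frequently_activated {κ : Type*} [IsProbabilityMeasure P] [Fintype ι] [Fintype κ]
    {ζ : κ → ℝ} {K : ℕ → Ω → Set κ} (hI : IsBlockSelection P N p I)
    (hK : IsBlockSelection P N ζ K) :
    ∀ᵐ ω ∂P, ∃ M, ∃ᶠ n in atTop, (∀ i, ∃ j, j ≤ n ∧ n ≤ j + M ∧ i ∈ I j ω) ∧
      ∀ k, ∃ j, j ≤ n ∧ n ≤ j + M ∧ k ∈ K j ω := by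
  have hq := hI.tendsto_sum_pow.add hK.tendsto_sum_pow
  rw [add_zero] at hq
  filter_upwards [ae_exists_frequently_notMem (P := P) (fun m n => (measure_union_le _ _).trans
    (add_le_add (hI.measure_exists_forall_notMem_le n m)
      (hK.measure_exists_forall_notMem_le n m))) hq] with ω hω
  obtain ⟨m, hm⟩ := hω
  refine ⟨m * N, ?_⟩
  -- The windows for `n` run forward from `n`; moving to `n + m * N` turns them into windows looking
  -- back.
  refine (tendsto_add_atTop_nat (m * N)).frequently (hm.mono fun n hn => ?_)
  simp only [Set.mem_union, Set.mem_ofPred_eq, not_or, not_exists, not_forall, not_not] at hn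
  refine ⟨fun i => ?_, fun k => ?_⟩
  · obtain ⟨j, h1, h2, h3⟩ := hn.1 i
    exact ⟨j, h2, by omega, h3⟩
  · obtain ⟨j, h1, h2, h3⟩ := hn.2 k
    exact ⟨j, h2, by omega, h3⟩

end Blocks

/-! ### Summability in expectation. -/

section Relaxation

variable {Ω : Type*} [MeasurableSpace Ω] {P : Measure Ω}

/-- A stochastic descent inequality with relaxation parameters independent of the steps forces the
steps to be almost surely summable. -/
theorem ae_summable_of_random_relaxation [IsProbabilityMeasure P] {Y D lam : ℕ → Ω → ℝ} {ρ c : ℝ}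
    (hY0 : Integrable (Y 0) P) (hYm : ∀ n, AEStronglyMeasurable (Y n) P)
    (hDm : ∀ n, AEStronglyMeasurable (D n) P) (hlm : ∀ n, AEStronglyMeasurable (lam n) P)
    (hY : ∀ n ω, 0 ≤ Y n ω) (hD : ∀ n ω, 0 ≤ D n ω) (hDY : ∀ n, ∀ᵐ ω ∂P, D n ω ≤ Y n ω)
    (hlam : ∀ n, ∀ᵐ ω ∂P, lam n ω ∈ Set.Icc 0 ρ)
    (hstep : ∀ n, ∀ᵐ ω ∂P, Y (n + 1) ω ≤ Y n ω - lam n ω * (2 - lam n ω) * D n ω)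
    (hind : ∀ n, IndepFun (lam n) (D n) P) (hc : 0 < c)
    (hlamc : ∀ n, c ≤ ∫ ω, lam n ω * (2 - lam n ω) ∂P) :
    ∀ᵐ ω ∂P, Summable fun n => D n ω := by
  have hl2m : ∀ n, AEStronglyMeasurable (fun ω => lam n ω * (2 - lam n ω)) P := fun n =>
    (hlm n).mul (aestronglyMeasurable_const.sub (hlm n))
  have hl2 : ∀ n, Integrable (fun ω => lam n ω * (2 - lam n ω)) P := fun n => by
    refine Integrable.of_bound (hl2m n) (ρ * (2 + ρ)) ?_
    filter_upwards [hlam n] with ω hω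
    rw [norm_mul, Real.norm_eq_abs, Real.norm_eq_abs, abs_of_nonneg hω.1]
    have h1 : |2 - lam n ω| ≤ 2 + ρ := abs_le.2 ⟨by linarith [hω.2], by linarith [hω.1, hω.2]⟩
    have := hω.1.trans hω.2
    gcongr
    exact hω.2
  have hind2 : ∀ n, IndepFun (fun ω => lam n ω * (2 - lam n ω)) (D n) P := fun n =>
    (hind n).comp (φ := fun r : ℝ => r * (2 - r)) (ψ := id) (by fun_prop) measurable_id
  have hDint : ∀ n, Integrable (Y n) P → Integrable (D n) P := fun n hn => by
    refine hn.mono' (hDm n) ?_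
    filter_upwards [hDY n] with ω hω
    rwa [Real.norm_eq_abs, abs_of_nonneg (hD n ω)]
  have hprod : ∀ n, Integrable (Y n) P →
      Integrable (fun ω => lam n ω * (2 - lam n ω) * D n ω) P := fun n hn =>
    (hind2 n).integrable_mul (hl2 n) (hDint n hn)
  -- Integrability propagates by induction: `D n` is dominated by `Y n`, and independence makes its
  -- product with the relaxation factor integrable.
  have hYint : ∀ n, Integrable (Y n) P := fun n => by
    induction n with
    | zero => exact hY0
    | succ n ih =>
      refine (ih.sub (hprod n ih)).mono' (hYm (n + 1)) ?_
      filter_upwards [hstep n] with ω hω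
      rwa [Real.norm_eq_abs, abs_of_nonneg (hY _ ω)]
  have hdesc : ∀ n, ∫ ω, Y (n + 1) ω ∂P ≤ ∫ ω, Y n ω ∂P - c * ∫ ω, D n ω ∂P := fun n => by
    have h1 := integral_mono_ae (hYint (n + 1)) ((hYint n).sub (hprod n (hYint n))) (hstep n)
    rw [integral_sub' (hYint n) (hprod n (hYint n)),
      (hind2 n).integral_fun_mul_eq_mul_integral (hl2m n) (hDm n)] at h1
    have h2 := mul_le_mul_of_nonneg_right (hlamc n) (integral_nonneg (μ := P) (hD n))
    linarith
  have hsum : ∀ n, c * ∑ j ∈ Finset.range n, ∫ ω, D j ω ∂P ≤ ∫ ω, Y 0 ω ∂P - ∫ ω, Y n ω ∂P :=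
    fun n => by
      induction n with
      | zero => simp
      | succ n ih =>
        rw [Finset.sum_range_succ, mul_add]
        linarith [hdesc n]
  have hsummable : Summable fun n => ∫ ω, D n ω ∂P := by
    refine summable_of_sum_range_le (c := (∫ ω, Y 0 ω ∂P) / c)
      (fun n => integral_nonneg (hD n)) fun n => ?_
    rw [le_div_iff₀ hc, mul_comm]
    linarith [hsum n, integral_nonneg (μ := P) (show 0 ≤ Y n from hY n)]
  have hm : ∀ n, AEMeasurable (fun ω => ENNReal.ofReal (D n ω)) P := fun n =>
    (hDm n).aemeasurable.ennreal_ofReal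
  -- Tonelli: a series with finite expectation is almost surely finite.
  have hfin : ∫⁻ ω, ∑' n, ENNReal.ofReal (D n ω) ∂P ≠ ⊤ := by
    rw [lintegral_tsum hm]
    simp_rw [← fun n => ofReal_integral_eq_lintegral_ofReal (hDint n (hYint n))
      (Eventually.of_forall (hD n))]
    exact hsummable.tsum_ofReal_ne_top
  filter_upwards [ae_lt_top' (AEMeasurable.tsum hm) hfin] with ω hω
  refine (ENNReal.summable_toReal hω.ne).congr fun n => ?_
  rw [ENNReal.toReal_ofReal (hD n ω)]

end Relaxation

/-! ### Measurability of the iterates. -/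

section Measurability

theorem aemeasurable_of_ae_cases {Ω E : Type*} [MeasurableSpace Ω] [MeasurableSpace E]
    {P : Measure Ω} {S : Set Ω} (hS : MeasurableSet S) {f g g' : Ω → E} (hg : AEMeasurable g P)
    (hg' : AEMeasurable g' P) (h : ∀ᵐ ω ∂P, ω ∈ S → f ω = g ω)
    (h' : ∀ᵐ ω ∂P, ω ∉ S → f ω = g' ω) : AEMeasurable f P := by
  classical
  refine ⟨S.piecewise (hg.mk g) (hg'.mk g'), hg.measurable_mk.piecewise hS hg'.measurable_mk, ?_⟩
  filter_upwards [h, h', hg.ae_eq_mk, hg'.ae_eq_mk] with ω h1 h2 h3 h4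
  by_cases hω : ω ∈ S
  · rw [Set.piecewise_eq_of_mem _ _ _ hω, h1 hω, h3]
  · rw [Set.piecewise_eq_of_notMem _ _ _ hω, h2 hω, h4]

variable {Ω : Type*} [MeasurableSpace Ω] {P : Measure Ω}
  {ι κ : Type*} [Fintype ι] [Fintype κ]
  {H : ι → Type*} [∀ i, NormedAddCommGroup (H i)] [∀ i, InnerProductSpace ℝ (H i)]
  [∀ i, FiniteDimensional ℝ (H i)] [∀ i, MeasurableSpace (H i)] [∀ i, BorelSpace (H i)]
  {G : κ → Type*} [∀ k, NormedAddCommGroup (G k)] [∀ k, InnerProductSpace ℝ (G k)]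
  [∀ k, FiniteDimensional ℝ (G k)] [∀ k, MeasurableSpace (G k)] [∀ k, BorelSpace (G k)]

theorem measurable_sqNorm : Measurable fun z : (∀ i, H i) × (∀ k, G k) => sqNorm z.1 z.2 := by
  unfold sqNorm
  fun_prop

theorem aemeasurable_sqNorm {y : Ω → ∀ i, H i} {u : Ω → ∀ k, G k}
    (hy : ∀ i, AEMeasurable (fun ω => y ω i) P) (hu : ∀ k, AEMeasurable (fun ω => u ω k) P) :
    AEMeasurable (fun ω => sqNorm (y ω) (u ω)) P := by
  unfold sqNorm
  exact (Finset.aemeasurable_fun_sum _ fun i _ => (hy i).norm.pow_const 2).add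
    (Finset.aemeasurable_fun_sum _ fun k _ => (hu k).norm.pow_const 2)

theorem aemeasurable_sqDist {y : Ω → ∀ i, H i} {u : Ω → ∀ k, G k}
    (hy : ∀ i, AEMeasurable (fun ω => y ω i) P) (hu : ∀ k, AEMeasurable (fun ω => u ω k) P)
    (w : (∀ i, H i) × (∀ k, G k)) : AEMeasurable (fun ω => sqDist (y ω) (u ω) w) P :=
  aemeasurable_sqNorm (y := fun ω i => y ω i - w.1 i) (u := fun ω k => u ω k - w.2 k)
    (fun i => (hy i).sub aemeasurable_const) fun k => (hu k).sub aemeasurable_const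

theorem integrable_sqDist [IsFiniteMeasure P] {y : Ω → ∀ i, H i} {u : Ω → ∀ k, G k}
    (hy : ∀ i, MemLp (fun ω => y ω i) 2 P) (hu : ∀ k, MemLp (fun ω => u ω k) 2 P)
    (w : (∀ i, H i) × (∀ k, G k)) : Integrable (fun ω => sqDist (y ω) (u ω) w) P := by
  have h1 : ∀ i, Integrable (fun ω => ‖y ω i - w.1 i‖ ^ 2) P := fun i =>
    ((hy i).sub (memLp_const (w.1 i))).integrable_norm_pow two_ne_zero
  have h2 : ∀ k, Integrable (fun ω => ‖u ω k - w.2 k‖ ^ 2) P := fun k =>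
    ((hu k).sub (memLp_const (w.2 k))).integrable_norm_pow two_ne_zero
  unfold sqDist
  exact (integrable_finsetSum _ fun i _ => h1 i).add (integrable_finsetSum _ fun k _ => h2 k)

theorem aemeasurable_sum_linearMap (T : ∀ k i, H i →ₗ[ℝ] G k) {y : Ω → ∀ i, H i}
    (hy : ∀ i, AEMeasurable (fun ω => y ω i) P) (k : κ) :
    AEMeasurable (fun ω => ∑ i, T k i (y ω i)) P :=
  Finset.aemeasurable_fun_sum _ fun i _ =>
    (T k i).continuous_of_finiteDimensional.measurable.comp_aemeasurable (hy i)

variable {A : ∀ i, H i → Set (H i)} {B : ∀ k, G k → Set (G k)} {L : ∀ k i, H i →ₗ[ℝ] G k}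
  {N : ℕ} {p : ι → ℝ} {ζ : κ → ℝ} {I : ℕ → Ω → Set ι} {K : ℕ → Ω → Set κ}
  {γ : ℕ → ι → ℝ} {μ : ℕ → κ → ℝ} {lam : ℕ → Ω → ℝ}
  {x : ℕ → Ω → ∀ i, H i} {v : ℕ → Ω → ∀ k, G k}
  {a as : ℕ → Ω → ∀ i, H i} {b bs : ℕ → Ω → ∀ k, G k}
  {ts : ℕ → Ω → ∀ i, H i} {t : ℕ → Ω → ∀ k, G k} {Δ θ : ℕ → Ω → ℝ}

/-- The recursion fixes `a n ω i` and `as n ω i` by a formula only where `i` is activated; `g` and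
`g'` evaluate that formula at every outcome, with a continuous extension of the resolvent. -/
theorem exists_aemeasurable_primal_active (hA : ∀ i, IsMaximallyMonotone (A i))
    (hγ : ∀ n i, 0 < γ n i)
    (halg : ∀ᵐ ω ∂P, IsTrajectory A B L γ μ (fun n => I n ω) (fun n => K n ω)
      (fun n => lam n ω) (fun n => x n ω) (fun n => v n ω) (fun n => a n ω) (fun n => as n ω)
      (fun n => b n ω) (fun n => bs n ω) (fun n => ts n ω) (fun n => t n ω)
      (fun n => Δ n ω) (fun n => θ n ω)) {n : ℕ}
    (hx : ∀ i, AEMeasurable (fun ω => x n ω i) P) (hv : ∀ k, AEMeasurable (fun ω => v n ω k) P)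
    (i : ι) :
    ∃ g g' : Ω → H i, AEMeasurable g P ∧ AEMeasurable g' P ∧
      ∀ᵐ ω ∂P, i ∈ I n ω → a n ω i = g ω ∧ as n ω i = g' ω := by
  obtain ⟨J, hJ, hJeq⟩ := (hA i).exists_continuous_eq_resolventOp (hγ n i)
  have hl : AEMeasurable (fun ω => ∑ k, (L k i).adjoint (v n ω k)) P :=
    aemeasurable_sum_linearMap (fun i k => (L k i).adjoint) hv i
  have hg : AEMeasurable
      (fun ω => J (x n ω i - γ n i • ∑ k, (L k i).adjoint (v n ω k))) P :=
    hJ.measurable.comp_aemeasurable ((hx i).sub (hl.const_smul (γ n i)))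
  refine ⟨_, _, hg, (((hx i).sub hg).const_smul (γ n i)⁻¹).sub hl, ?_⟩
  filter_upwards [halg] with ω hω hi
  have h1 := hJeq _ _ (hω.a_active n i hi)
  refine ⟨h1, ?_⟩
  simp only [Pi.sub_apply, Pi.smul_apply]
  rw [← h1]
  exact hω.as_active n i hi

theorem exists_aemeasurable_dual_active (hB : ∀ k, IsMaximallyMonotone (B k))
    (hμ : ∀ n k, 0 < μ n k)
    (halg : ∀ᵐ ω ∂P, IsTrajectory A B L γ μ (fun n => I n ω) (fun n => K n ω)
      (fun n => lam n ω) (fun n => x n ω) (fun n => v n ω) (fun n => a n ω) (fun n => as n ω)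
      (fun n => b n ω) (fun n => bs n ω) (fun n => ts n ω) (fun n => t n ω)
      (fun n => Δ n ω) (fun n => θ n ω)) {n : ℕ}
    (hx : ∀ i, AEMeasurable (fun ω => x n ω i) P) (hv : ∀ k, AEMeasurable (fun ω => v n ω k) P)
    (k : κ) :
    ∃ g g' : Ω → G k, AEMeasurable g P ∧ AEMeasurable g' P ∧
      ∀ᵐ ω ∂P, k ∈ K n ω → b n ω k = g ω ∧ bs n ω k = g' ω := by
  obtain ⟨J, hJ, hJeq⟩ := (hB k).exists_continuous_eq_resolventOp (hμ n k)
  have hl : AEMeasurable (fun ω => ∑ i, L k i (x n ω i)) P := aemeasurable_sum_linearMap L hx k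
  have hg : AEMeasurable (fun ω => J (∑ i, L k i (x n ω i) + μ n k • v n ω k)) P :=
    hJ.measurable.comp_aemeasurable (hl.add ((hv k).const_smul (μ n k)))
  refine ⟨_, _, hg, (hv k).add ((hl.sub hg).const_smul (μ n k)⁻¹), ?_⟩
  filter_upwards [halg] with ω hω hk
  have h1 := hJeq _ _ (hω.b_active n k hk)
  refine ⟨h1, ?_⟩
  simp only [Pi.sub_apply, Pi.smul_apply, Pi.add_apply]
  rw [← h1]
  exact hω.bs_active n k hk

theorem aemeasurable_direction
    (halg : ∀ᵐ ω ∂P, IsTrajectory A B L γ μ (fun n => I n ω) (fun n => K n ω)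
      (fun n => lam n ω) (fun n => x n ω) (fun n => v n ω) (fun n => a n ω) (fun n => as n ω)
      (fun n => b n ω) (fun n => bs n ω) (fun n => ts n ω) (fun n => t n ω)
      (fun n => Δ n ω) (fun n => θ n ω)) {n : ℕ}
    (hx : ∀ i, AEMeasurable (fun ω => x n ω i) P) (hv : ∀ k, AEMeasurable (fun ω => v n ω k) P)
    (ha : ∀ i, AEMeasurable (fun ω => a n ω i) P) (has : ∀ i, AEMeasurable (fun ω => as n ω i) P)
    (hb : ∀ k, AEMeasurable (fun ω => b n ω k) P)
    (hbs : ∀ k, AEMeasurable (fun ω => bs n ω k) P) :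
    (∀ i, AEMeasurable (fun ω => ts n ω i) P) ∧ (∀ k, AEMeasurable (fun ω => t n ω k) P) ∧
      AEMeasurable (θ n) P := by
  have hts : ∀ i, AEMeasurable (fun ω => ts n ω i) P := fun i => by
    refine ((has i).add (aemeasurable_sum_linearMap (fun i k => (L k i).adjoint) hbs i)).congr ?_
    filter_upwards [halg] with ω hω
    exact (hω.ts_eq n i).symm
  have ht : ∀ k, AEMeasurable (fun ω => t n ω k) P := fun k => by
    refine ((hb k).sub (aemeasurable_sum_linearMap L ha k)).congr ?_
    filter_upwards [halg] with ω hω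
    exact (hω.t_eq n k).symm
  have hΔ : AEMeasurable (Δ n) P := by
    have h1 : AEMeasurable (fun ω =>
        ∑ i, (inner ℝ (x n ω i) (ts n ω i) - inner ℝ (a n ω i) (as n ω i)) +
        ∑ k, (inner ℝ (t n ω k) (v n ω k) - inner ℝ (b n ω k) (bs n ω k))) P :=
      (Finset.aemeasurable_fun_sum _ fun i _ =>
        ((hx i).inner (hts i)).sub ((ha i).inner (has i))).add
      (Finset.aemeasurable_fun_sum _ fun k _ =>
        ((ht k).inner (hv k)).sub ((hb k).inner (hbs k)))
    refine h1.congr ?_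
    filter_upwards [halg] with ω hω
    exact (hω.Δ_eq n).symm
  refine ⟨hts, ht, ?_⟩
  have hψ : Measurable fun d : ℝ × ℝ =>
      (if 0 < d.1 then d.1 else 0) / (d.2 + (if d.1 ≤ 0 then 1 else 0)) :=
    (Measurable.ite (measurableSet_lt measurable_const measurable_fst) measurable_fst
      measurable_const).div (measurable_snd.add (Measurable.ite
        (measurableSet_le measurable_fst measurable_const) measurable_const measurable_const))
  have hS : AEMeasurable (fun ω => ∑ i, ‖ts n ω i‖ ^ 2 + ∑ k, ‖t n ω k‖ ^ 2) P :=
    (Finset.aemeasurable_fun_sum _ fun i _ => (hts i).norm.pow_const 2).add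
      (Finset.aemeasurable_fun_sum _ fun k _ => (ht k).norm.pow_const 2)
  refine (hψ.comp_aemeasurable (hΔ.prodMk hS)).congr ?_
  filter_upwards [halg] with ω hω
  exact (hω.θ_eq n).symm

/-- Induction on `n`, gluing along the measurable event of activation the resolvent formula and the
previous value. At time `0` there is no previous value, but all blocks are active. -/
theorem aemeasurable_iterates (hA : ∀ i, IsMaximallyMonotone (A i))
    (hB : ∀ k, IsMaximallyMonotone (B k)) (hγ : ∀ n i, 0 < γ n i) (hμ : ∀ n k, 0 < μ n k)
    (hI : IsBlockSelection P N p I) (hK : IsBlockSelection P N ζ K)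
    (halg : ∀ᵐ ω ∂P, IsTrajectory A B L γ μ (fun n => I n ω) (fun n => K n ω)
      (fun n => lam n ω) (fun n => x n ω) (fun n => v n ω) (fun n => a n ω) (fun n => as n ω)
      (fun n => b n ω) (fun n => bs n ω) (fun n => ts n ω) (fun n => t n ω)
      (fun n => Δ n ω) (fun n => θ n ω))
    (hlam : ∀ n, AEMeasurable (lam n) P)
    (hx0 : ∀ i, AEMeasurable (fun ω => x 0 ω i) P) (hv0 : ∀ k, AEMeasurable (fun ω => v 0 ω k) P)
    (n : ℕ) :
    (∀ i, AEMeasurable (fun ω => x n ω i) P) ∧ (∀ k, AEMeasurable (fun ω => v n ω k) P) ∧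
    (∀ i, AEMeasurable (fun ω => a n ω i) P) ∧ (∀ i, AEMeasurable (fun ω => as n ω i) P) ∧
    (∀ k, AEMeasurable (fun ω => b n ω k) P) ∧ (∀ k, AEMeasurable (fun ω => bs n ω k) P) := by
  induction n with
  | zero =>
    have h1 := exists_aemeasurable_primal_active hA hγ halg hx0 hv0
    have h2 := exists_aemeasurable_dual_active hB hμ halg hx0 hv0
    choose g g' hg hg' hgg using h1
    choose e e' he he' hee using h2
    refine ⟨hx0, hv0, fun i => (hg i).congr ?_, fun i => (hg' i).congr ?_,
      fun k => (he k).congr ?_, fun k => (he' k).congr ?_⟩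
    · filter_upwards [hgg i, hI.zero] with ω h h0 using (h (by simp [h0])).1.symm
    · filter_upwards [hgg i, hI.zero] with ω h h0 using (h (by simp [h0])).2.symm
    · filter_upwards [hee k, hK.zero] with ω h h0 using (h (by simp [h0])).1.symm
    · filter_upwards [hee k, hK.zero] with ω h h0 using (h (by simp [h0])).2.symm
  | succ n ih =>
    obtain ⟨hx, hv, ha, has, hb, hbs⟩ := ih
    obtain ⟨hts, ht, hθ⟩ := aemeasurable_direction halg hx hv ha has hb hbs
    have hx' : ∀ i, AEMeasurable (fun ω => x (n + 1) ω i) P := fun i => by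
      refine ((hx i).sub (((hlam n).mul hθ).smul (hts i))).congr ?_
      filter_upwards [halg] with ω hω using (hω.x_succ n i).symm
    have hv' : ∀ k, AEMeasurable (fun ω => v (n + 1) ω k) P := fun k => by
      refine ((hv k).sub (((hlam n).mul hθ).smul (ht k))).congr ?_
      filter_upwards [halg] with ω hω using (hω.v_succ n k).symm
    have h1 := exists_aemeasurable_primal_active hA hγ halg hx' hv'
    have h2 := exists_aemeasurable_dual_active hB hμ halg hx' hv'
    choose g g' hg hg' hgg using h1
    choose e e' he he' hee using h2
    refine ⟨hx', hv',
      fun i => aemeasurable_of_ae_cases (hI.measurableSet_mem (n + 1) i) (hg i) (ha i) ?_ ?_,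
      fun i => aemeasurable_of_ae_cases (hI.measurableSet_mem (n + 1) i) (hg' i) (has i) ?_ ?_,
      fun k => aemeasurable_of_ae_cases (hK.measurableSet_mem (n + 1) k) (he k) (hb k) ?_ ?_,
      fun k => aemeasurable_of_ae_cases (hK.measurableSet_mem (n + 1) k) (he' k) (hbs k) ?_ ?_⟩
    · filter_upwards [hgg i] with ω h hi using (h hi).1
    · filter_upwards [halg] with ω hω hi using hω.a_inactive n i hi
    · filter_upwards [hgg i] with ω h hi using (h hi).2
    · filter_upwards [halg] with ω hω hi using hω.as_inactive n i hi
    · filter_upwards [hee k] with ω h hk using (h hk).1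
    · filter_upwards [halg] with ω hω hk using hω.b_inactive n k hk
    · filter_upwards [hee k] with ω h hk using (h hk).2
    · filter_upwards [halg] with ω hω hk using hω.bs_inactive n k hk

end Measurability

/-- An almost sure limit of almost everywhere measurable maps, known to lie almost surely in a
nonempty set `S`, is almost surely equal to a measurable map with values in `S`. -/
theorem exists_measurable_mem_ae_tendsto {Ω E : Type*} [MeasurableSpace Ω] {P : Measure Ω}
    [TopologicalSpace E] [TopologicalSpace.PseudoMetrizableSpace E] [MeasurableSpace E]
    [BorelSpace E] {f : ℕ → Ω → E} (hf : ∀ n, AEMeasurable (f n) P) {S : Set E} (hS : S.Nonempty)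
    (h : ∀ᵐ ω ∂P, ∃ z ∈ S, Tendsto (fun n => f n ω) atTop (𝓝 z)) :
    ∃ g : Ω → E, Measurable g ∧ (∀ ω, g ω ∈ S) ∧
      ∀ᵐ ω ∂P, Tendsto (fun n => f n ω) atTop (𝓝 (g ω)) := by
  classical
  obtain ⟨s, hs⟩ := hS
  let l : Ω → E := fun ω =>
    if hω : ∃ z ∈ S, Tendsto (fun n => f n ω) atTop (𝓝 z) then hω.choose else s
  have hl : ∀ ω, l ω ∈ S := fun ω => by
    by_cases hω : ∃ z ∈ S, Tendsto (fun n => f n ω) atTop (𝓝 z)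
    · simp only [l, dif_pos hω]
      exact hω.choose_spec.1
    · simpa only [l, dif_neg hω] using hs
  have hlim : ∀ᵐ ω ∂P, Tendsto (fun n => f n ω) atTop (𝓝 (l ω)) := by
    filter_upwards [h] with ω hω
    simp only [l, dif_pos hω]
    exact hω.choose_spec.2
  have hm : AEMeasurable l P := aemeasurable_of_tendsto_metrizable_ae atTop hf hlim
  -- Since `S` is not assumed measurable, the measurable version of `l` is kept only off a
  -- measurable null set, and replaced there by the constant `s`.
  let T := toMeasurable P {ω | ¬l ω = hm.mk l ω}
  have hT : MeasurableSet T := measurableSet_toMeasurable _ _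
  have hT0 : ∀ᵐ ω ∂P, ω ∉ T := by
    rw [ae_iff]
    simp only [not_not]
    exact (measure_toMeasurable _).trans (ae_iff.1 hm.ae_eq_mk)
  have heq : ∀ ω, ω ∉ T → l ω = hm.mk l ω := fun ω hω => by
    by_contra hne
    exact hω (subset_toMeasurable P _ hne)
  refine ⟨T.piecewise (fun _ => s) (hm.mk l), measurable_const.piecewise hT hm.measurable_mk,
    fun ω => ?_, ?_⟩
  · by_cases hω : ω ∈ T
    · rwa [Set.piecewise_eq_of_mem _ _ _ hω]
    · rw [Set.piecewise_eq_of_notMem _ _ _ hω, ← heq ω hω]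
      exact hl ω
  · filter_upwards [hlim, hT0] with ω h1 h2
    rwa [Set.piecewise_eq_of_notMem _ _ _ h2, ← heq ω h2]

end KTSplitting

/-! ### Assembly of the convergence theorem. -/

theorem theorem6p3
    {Ω : Type*} [MeasurableSpace Ω] (P : Measure Ω) [IsProbabilityMeasure P]
    -- the primal-dual inclusion problem
    {ι κ : Type*} [Fintype ι] [Fintype κ] [Nonempty ι] [Nonempty κ]
    {H : ι → Type*} [∀ i, NormedAddCommGroup (H i)] [∀ i, InnerProductSpace ℝ (H i)]
    [∀ i, FiniteDimensional ℝ (H i)] [∀ i, MeasurableSpace (H i)] [∀ i, BorelSpace (H i)]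
    {G : κ → Type*} [∀ k, NormedAddCommGroup (G k)] [∀ k, InnerProductSpace ℝ (G k)]
    [∀ k, FiniteDimensional ℝ (G k)] [∀ k, MeasurableSpace (G k)] [∀ k, BorelSpace (G k)]
    (A : ∀ i, H i → Set (H i)) (hA : ∀ i, KTSplitting.IsMaximallyMonotone (A i))
    (B : ∀ k, G k → Set (G k)) (hB : ∀ k, KTSplitting.IsMaximallyMonotone (B k))
    (L : ∀ k i, H i →ₗ[ℝ] G k)
    -- random selection of the blocks
    (N : ℕ) (hN : N ≠ 0) (p : ι → ℝ) (ζ : κ → ℝ)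
    (I : ℕ → Ω → Set ι) (hI : KTSplitting.IsBlockSelection P N p I)
    (K : ℕ → Ω → Set κ) (hK : KTSplitting.IsBlockSelection P N ζ K)
    -- proximal parameters
    (ε : ℝ) (hε : ε ∈ Set.Ioo (0 : ℝ) 1)
    (γ : ℕ → ι → ℝ) (hγ : ∀ n i, γ n i ∈ Set.Icc ε (1 / ε))
    (μ : ℕ → κ → ℝ) (hμ : ∀ n k, μ n k ∈ Set.Icc ε (1 / ε))
    -- random relaxation parameters
    (ρ : ℝ) (hρ : 2 ≤ ρ)
    (lam : ℕ → Ω → ℝ) (hlam : ∀ n, MemLp (lam n) ⊤ P)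
    (hlam_mem : ∀ n, ∀ᵐ ω ∂P, lam n ω ∈ Set.Icc ε ρ)
    -- the sequences generated by the algorithm
    (x : ℕ → Ω → ∀ i, H i) (v : ℕ → Ω → ∀ k, G k)
    (a as : ℕ → Ω → ∀ i, H i) (b bs : ℕ → Ω → ∀ k, G k)
    (ts : ℕ → Ω → ∀ i, H i) (t : ℕ → Ω → ∀ k, G k) (Δ θ : ℕ → Ω → ℝ)
    (hx0 : ∀ i, MemLp (fun ω => x 0 ω i) 2 P)
    (hv0 : ∀ k, MemLp (fun ω => v 0 ω k) 2 P)
    (halg : ∀ᵐ ω ∂P, KTSplitting.IsTrajectory A B L γ μ (fun n => I n ω) (fun n => K n ω)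
      (fun n => lam n ω) (fun n => x n ω) (fun n => v n ω) (fun n => a n ω) (fun n => as n ω)
      (fun n => b n ω) (fun n => bs n ω) (fun n => ts n ω) (fun n => t n ω)
      (fun n => Δ n ω) (fun n => θ n ω))
    -- `lam n` is independent of the iterates up to time `n` and of the direction
    -- `d_n = θ_n (t*_n, t_n)`
    (hindep : ∀ n, IndepFun (lam n)
      (fun ω => ((fun j : Fin (n + 1) => (x j ω, v j ω)),
        ((fun i => θ n ω • ts n ω i), (fun k => θ n ω • t n ω k)))) P)
    -- hypotheses of the theorem
    (hD : (KTSplitting.dualSolutions A B L).Nonempty)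
    (hinf : 0 < ⨅ n, ∫ ω, lam n ω * (2 - lam n ω) ∂P) :
    ∃ (xbar : Ω → ∀ i, H i) (vbar : Ω → ∀ k, G k),
      Measurable xbar ∧ (∀ ω, xbar ω ∈ KTSplitting.primalSolutions A B L) ∧
      Measurable vbar ∧ (∀ ω, vbar ω ∈ KTSplitting.dualSolutions A B L) ∧
      (∀ i, ∀ᵐ ω ∂P, Tendsto (fun n => x n ω i) atTop (𝓝 (xbar ω i))) ∧
      (∀ k, ∀ᵐ ω ∂P, Tendsto (fun n => v n ω k) atTop (𝓝 (vbar ω k))) := by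
  have hε0 : 0 < ε := hε.1
  have hγ0 : ∀ n i, 0 < γ n i := fun n i => hε0.trans_le (hγ n i).1
  have hμ0 : ∀ n k, 0 < μ n k := fun n k => hε0.trans_le (hμ n k).1
  have hne := KTSplitting.kuhnTucker_nonempty hD
  obtain ⟨w, hw⟩ := id hne
  have hlm : ∀ n, AEMeasurable (lam n) P := fun n => (hlam n).aestronglyMeasurable.aemeasurable
  have hmeas := KTSplitting.aemeasurable_iterates hA hB hγ0 hμ0 hI hK halg hlm
    (fun i => (hx0 i).aestronglyMeasurable.aemeasurable)
    (fun k => (hv0 k).aestronglyMeasurable.aemeasurable)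
  have hxm : ∀ n i, AEMeasurable (fun ω => x n ω i) P := fun n => (hmeas n).1
  have hvm : ∀ n k, AEMeasurable (fun ω => v n ω k) P := fun n => (hmeas n).2.1
  have hdir : ∀ n, AEMeasurable (fun ω => KTSplitting.sqNorm (fun i => θ n ω • ts n ω i)
      (fun k => θ n ω • t n ω k)) P := fun n => by
    obtain ⟨h1, h2, h3, h4, h5, h6⟩ := hmeas n
    obtain ⟨hts, ht, hθ⟩ := KTSplitting.aemeasurable_direction halg h1 h2 h3 h4 h5 h6
    exact KTSplitting.aemeasurable_sqNorm (fun i => hθ.smul (hts i)) fun k => hθ.smul (ht k)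
  have hYm : ∀ n, AEMeasurable (fun ω => KTSplitting.sqDist (x n ω) (v n ω) w) P := fun n =>
    KTSplitting.aemeasurable_sqDist (hxm n) (hvm n) w
  have hY0 := KTSplitting.integrable_sqDist hx0 hv0 w
  have hind : ∀ n, IndepFun (lam n) (fun ω => KTSplitting.sqNorm (fun i => θ n ω • ts n ω i)
      (fun k => θ n ω • t n ω k)) P := fun n => by
    have hψ : Measurable fun y : (Fin (n + 1) → (∀ i, H i) × (∀ k, G k)) ×
        ((∀ i, H i) × (∀ k, G k)) => KTSplitting.sqNorm y.2.1 y.2.2 :=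
      KTSplitting.measurable_sqNorm.comp measurable_snd
    exact (hindep n).comp measurable_id hψ
  have hlamc : ∀ n, ⨅ n, ∫ ω, lam n ω * (2 - lam n ω) ∂P ≤ ∫ ω, lam n ω * (2 - lam n ω) ∂P :=
    fun n => by
      refine ciInf_le ?_ n
      -- The infimum of a real family unbounded below is `0` by convention, which would contradict
      -- `hinf`.
      by_contra hbdd
      rw [iInf, Real.sInf_of_not_bddBelow hbdd] at hinf
      exact lt_irrefl _ hinf
  have hsum := KTSplitting.ae_summable_of_random_relaxation (P := P) (ρ := ρ)
    (Y := fun n ω => KTSplitting.sqDist (x n ω) (v n ω) w)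
    (D := fun n ω => KTSplitting.sqNorm (fun i => θ n ω • ts n ω i) (fun k => θ n ω • t n ω k))
    hY0 (fun n => (hYm n).aestronglyMeasurable) (fun n => (hdir n).aestronglyMeasurable)
    (fun n => (hlm n).aestronglyMeasurable) (fun n ω => KTSplitting.sqDist_nonneg _ _ _)
    (fun n ω => KTSplitting.sqNorm_nonneg _ _)
    (fun n => by
      filter_upwards [halg, hI.zero, hK.zero] with ω h hI0 hK0
      exact h.sqNorm_direction_le_sqDist hA hB hγ0 hμ0 hI0 hK0 hw n)
    (fun n => by
      filter_upwards [hlam_mem n] with ω h using ⟨hε0.le.trans h.1, h.2⟩)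
    (fun n => by
      filter_upwards [halg, hI.zero, hK.zero, hlam_mem n] with ω h hI0 hK0 hl
      exact h.sqDist_succ_le hA hB hγ0 hμ0 hI0 hK0 hw (hε0.le.trans hl.1))
    hind
    hinf hlamc
  -- Summability was obtained from the single point `w`, but it no longer mentions `w`; hence one
  -- null set serves for all Kuhn–Tucker points.
  have hconv : ∀ᵐ ω ∂P, ∃ z ∈ KTSplitting.kuhnTucker A B L,
      Tendsto (fun n => (x n ω, v n ω)) atTop (𝓝 z) := by
    filter_upwards [halg, hI.zero, hK.zero, ae_all_iff.2 hlam_mem, hsum,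
      KTSplitting.ae_exists_frequently_activated hI hK] with ω h hI0 hK0 hl hs hact
    obtain ⟨M, hM⟩ := hact
    obtain ⟨z, hz, hzx, hzv⟩ :=
      h.exists_mem_kuhnTucker_tendsto hA hB hε0 hγ hμ hI0 hK0 hne hl hs hM
    exact ⟨z, hz, (tendsto_pi_nhds.2 hzx).prodMk_nhds (tendsto_pi_nhds.2 hzv)⟩
  -- Treating the pair at once makes both limits coordinates of one measurable map into the
  -- Kuhn–Tucker set.
  obtain ⟨g, hg, hgmem, hglim⟩ := KTSplitting.exists_measurable_mem_ae_tendsto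
    (fun n => (aemeasurable_pi_lambda _ fun i => hxm n i).prodMk
      (aemeasurable_pi_lambda _ fun k => hvm n k)) hne hconv
  refine ⟨fun ω => (g ω).1, fun ω => (g ω).2, hg.fst,
    fun ω => KTSplitting.fst_mem_primalSolutions (hgmem ω), hg.snd,
    fun ω => KTSplitting.snd_mem_dualSolutions (hgmem ω), fun i => ?_, fun k => ?_⟩
  · filter_upwards [hglim] with ω hω
    exact tendsto_pi_nhds.1 ((continuous_fst.tendsto _).comp hω) i
  · filter_upwards [hglim] with ω hω
    exact tendsto_pi_nhds.1 ((continuous_snd.tendsto _).comp hω) k
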